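/- **Setting.** There are $n$ players. The secret $X$ takes values in a countable set $\mathcal X$, and $L=(L_1,\dots,L_n)\in\{0,1\}^n$, where $L_i=1$ means that player $i$ knows $X$ (is a leaker). The joint distribution $\mu$ of $(X,L)$ is arbitrary. A *collaborating cryptogenography protocol* $\pi$ specifies, for each partial transcript $t$ (a finite sequence of messages), whether the communication stops; and if not, which player $i$ sends the next message, a distribution $p_?$ from which player $i$ chooses this message if $L_i=0$, and distributions $p_x$ ($x\in\mathcal X$), where $p_x$ is used if $L_i=1$ and $X=x$. There is a number bounding the number of messages. $\pi$ is *non-revealing* (for $\mu$) if there are no partial transcript $t$, with player $j$ to send the next message, and message $a$ such that with positive probability the partial transcript $t$ occurs, $L_j=1$ and $j$ then sends $a$, while $p_?(a)=0$ at $t$. An *innocent communication protocol* $\iota$ has infinitely many rounds; in each round every player sends a message. For each player $j$ and each partial transcript $s^k$ of the first $k$ rounds, $\iota$ gives a finite set $\mathcal A_{j,s^k}$ of possible messages and a probability distribution on it, from which $j$ chooses the message in round $k+1$, independently of the other players' choices in that round. (All messages are from one countable alphabet.) Let $p_{\max,j}(s^k)$ be the largest probability of a message in this distribution. $\iota$ is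 *informative* if for each player $j$, $\prod_{k}p_{\max,j}(S^k)=0$ with probability $1$, where $S$ is the infinite transcript of $\iota$. A *protocol built on top of* $\iota$ specifies, for each $x\in\mathcal X$, player $j$ and partial transcript $s^k$ of $k$ rounds, a distribution on $\mathcal A_{j,s^k}$. In each round, each player $j$, independently of the others, chooses the message from this distribution if $L_j=1$ and $X=x$, and from the distribution given by $\iota$ if $L_j=0$ (so non-leakers follow $\iota$). Two protocols with transcripts $T$ and $T'$ are *equivalent* for a distribution of $(X,L)$ if the posterior distribution of $(X,L_1,\dots,L_n)$ given $T$ and that given $T'$, which are random probability measures, have the same distribution. **Theorem.** Let $\pi$ be a collaborating cryptogenography protocol that is non-revealing for $\mu$, and let $\iota$ be an informative innocent communication protocol. Then there is a protocol built on top of $\iota$ that is equivalent to $\pi$ for $\mu$, and indeed for every distribution of $(X,L)$ whose support is contained in that of $\mu$. -/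

import Mathlib

open MeasureTheory ProbabilityTheory Filter Topology

noncomputable section

namespace Cryptogenography

/-! ### Posterior distributions -/

/-- Two observations `κ`, `η` of the same hidden quantity with prior `ν` (`κ θ` and `η θ` are the
conditional laws of what is observed when the hidden quantity is `θ`) are equivalent if the
posterior distribution of the hidden quantity, which is a random probability measure, has the same
law for both. -/
def SamePosteriorLaw {Θ S T : Type*} [MeasurableSpace Θ] [StandardBorelSpace Θ] [Nonempty Θ]
    [MeasurableSpace S] [MeasurableSpace T] (ν : Measure Θ) [IsFiniteMeasure ν]
    (κ : Kernel Θ S) [IsFiniteKernel κ] (η : Kernel Θ T) [IsFiniteKernel η] : Prop :=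
  (κ ∘ₘ ν).map (κ†ν) = (η ∘ₘ ν).map (η†ν)

/-! ### Collaborating protocols

The secret is `x : 𝒳`, and `l i` says whether player `i` knows the secret (is a leaker). -/

/-- What a collaborating protocol prescribes while the communication continues: who sends the next
message, and from which distribution (`innocent` if the sender is not a leaker, `leaker x` if the
sender is a leaker and the secret is `x`). -/
structure Turn (n : ℕ) (𝒳 𝒜 : Type*) where
  player : Fin n
  innocent : PMF 𝒜
  leaker : 𝒳 → PMF 𝒜

/-- The distribution of the message sent in this turn. -/
def Turn.message {n : ℕ} {𝒳 𝒜 : Type*} (τ : Turn n 𝒳 𝒜) (x : 𝒳) (l : Fin n → Bool) : PMF 𝒜 :=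
  if l τ.player then τ.leaker x else τ.innocent

/-- A collaborating cryptogenography protocol. For each partial transcript (the messages so far in
chronological order), `next` is `none` if the communication stops, and `some τ` if it continues
with turn `τ`. There are at most `length` messages. -/
structure CollabProtocol (n : ℕ) (𝒳 𝒜 : Type*) where
  next : List 𝒜 → Option (Turn n 𝒳 𝒜)
  length : ℕ
  terminates : ∀ t : List 𝒜, length ≤ t.length → next t = none

namespace CollabProtocol

variable {n : ℕ} {𝒳 𝒜 : Type*}

/-- The distribution of the next partial transcript, if the current one is `t`. -/
def step (π : CollabProtocol n 𝒳 𝒜) (x : 𝒳) (l : Fin n → Bool) (t : List 𝒜) : PMF (List 𝒜) :=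
  match π.next t with
  | none => PMF.pure t
  | some τ => (τ.message x l).map fun a => t ++ [a]

/-- The distribution of the transcript after the first `k` messages (the complete transcript, if
the communication stops earlier), given `X = x` and `L = l`. -/
def partialLaw (π : CollabProtocol n 𝒳 𝒜) (x : 𝒳) (l : Fin n → Bool) : ℕ → PMF (List 𝒜)
  | 0 => PMF.pure []
  | k + 1 => (π.partialLaw x l k).bind (π.step x l)

/-- The distribution of the complete transcript, given `X = x` and `L = l`. -/
def transcriptLaw (π : CollabProtocol n 𝒳 𝒜) (x : 𝒳) (l : Fin n → Bool) : PMF (List 𝒜) :=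
  π.partialLaw x l π.length

/-- `π` is non-revealing, when `(X, L)` has distribution `μ`: there are no partial transcript `t`
and message `a` such that the player to send the next message after `t` may, while being a leaker,
send `a` after `t` (that is, this happens with positive probability), although the player sends
`a` with probability `0` when not a leaker. -/
def NonRevealing (π : CollabProtocol n 𝒳 𝒜) (μ : PMF (𝒳 × (Fin n → Bool))) : Prop :=
  ∀ (t : List 𝒜) (τ : Turn n 𝒳 𝒜) (a : 𝒜), π.next t = some τ →
    (∃ (x : 𝒳) (l : Fin n → Bool), μ (x, l) ≠ 0 ∧ l τ.player = true ∧
      (∃ k, π.partialLaw x l k t ≠ 0) ∧ τ.leaker x a ≠ 0) →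
    τ.innocent a ≠ 0

end CollabProtocol

/-- Transcripts of collaborating protocols are discrete. -/
instance instMeasurableSpaceList {𝒜 : Type*} : MeasurableSpace (List 𝒜) := ⊤

/-- The conditional law of the complete transcript of `π`, given `(X, L)`. -/
def CollabProtocol.transcriptKernel {n : ℕ} {𝒳 𝒜 : Type*} [Countable 𝒳] [MeasurableSpace 𝒳]
    [DiscreteMeasurableSpace 𝒳] (π : CollabProtocol n 𝒳 𝒜) :
    Kernel (𝒳 × (Fin n → Bool)) (List 𝒜) where
  toFun θ := (π.transcriptLaw θ.1 θ.2).toMeasure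
  measurable' := Measurable.of_discrete

instance {n : ℕ} {𝒳 𝒜 : Type*} [Countable 𝒳] [MeasurableSpace 𝒳]
    [DiscreteMeasurableSpace 𝒳] (π : CollabProtocol n 𝒳 𝒜) :
    IsMarkovKernel π.transcriptKernel :=
  ⟨fun θ => inferInstanceAs (IsProbabilityMeasure (π.transcriptLaw θ.1 θ.2).toMeasure)⟩

/-! ### Communication in rounds

In each of infinitely many rounds every player sends one message. A round is an element of
`Fin n → M`, a partial transcript is the list of the rounds so far in chronological order, and an
infinite transcript is a sequence of rounds. -/

/-- The transcript of the first `k` rounds. -/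
def pre {R : Type*} (s : ℕ → R) (k : ℕ) : List R := List.ofFn fun i : Fin k => s i

section Rounds

variable {n : ℕ} {M : Type*} [Countable M] [MeasurableSpace M] [DiscreteMeasurableSpace M]

/-- The law of the next round after `s`, if player `j`, independently of the others, chooses the
next message from `d j s`. -/
def roundLaw (d : Fin n → List (Fin n → M) → PMF M) (s : List (Fin n → M)) :
    Measure (Fin n → M) :=
  Measure.pi fun j => (d j s).toMeasure

instance (d : Fin n → List (Fin n → M) → PMF M) (s : List (Fin n → M)) :
    IsProbabilityMeasure (roundLaw d s) :=
  inferInstanceAs (IsProbabilityMeasure (Measure.pi fun j => (d j s).toMeasure))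

/-- The conditional law of round `k + 1` given the rounds `0, …, k`. -/
def roundKernel (d : Fin n → List (Fin n → M) → PMF M) (k : ℕ) :
    Kernel (Π _ : Finset.Iic k, (Fin n → M)) (Fin n → M) where
  toFun h := roundLaw d (List.ofFn fun i : Fin (k + 1) =>
    h ⟨i, Finset.mem_Iic.2 (Nat.le_of_lt_succ i.2)⟩)
  measurable' := Measurable.of_discrete

instance (d : Fin n → List (Fin n → M) → PMF M) (k : ℕ) : IsMarkovKernel (roundKernel d k) :=
  ⟨fun h => inferInstanceAs (IsProbabilityMeasure (roundLaw d (List.ofFn fun i : Fin (k + 1) =>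
    h ⟨i, Finset.mem_Iic.2 (Nat.le_of_lt_succ i.2)⟩)))⟩

/-- The law of the infinite transcript, if in each round each player `j`, independently of the
others, chooses the next message from `d j s`, where `s` is the current partial transcript. -/
def roundsLaw (d : Fin n → List (Fin n → M) → PMF M) : Measure (ℕ → Fin n → M) :=
  Kernel.trajMeasure (X := fun _ => Fin n → M) (roundLaw d []) (roundKernel d)

instance (d : Fin n → List (Fin n → M) → PMF M) : IsProbabilityMeasure (roundsLaw d) :=
  inferInstanceAs (IsProbabilityMeasure
    (Kernel.trajMeasure (X := fun _ => Fin n → M) (roundLaw d []) (roundKernel d)))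

end Rounds

/-- An innocent communication protocol: for each player and each partial transcript, a finite set
of possible messages and a probability distribution on that set. -/
structure InnocentProtocol (n : ℕ) (M : Type*) where
  msgs : Fin n → List (Fin n → M) → Finset M
  dist : Fin n → List (Fin n → M) → PMF M
  support_subset : ∀ j s, (dist j s).support ⊆ msgs j s

namespace InnocentProtocol

variable {n : ℕ} {M : Type*}

/-- The largest probability of a message of player `j` in the round after `s`. -/
def pmax (ι : InnocentProtocol n M) (j : Fin n) (s : List (Fin n → M)) : ENNReal :=
  (ι.msgs j s).sup (ι.dist j s)

/-- For each player, almost surely `∏ₖ pmax (sᵏ) = 0`, where `s` is the random infinite transcript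
of `ι`. -/
def Informative [Countable M] [MeasurableSpace M] [DiscreteMeasurableSpace M]
    (ι : InnocentProtocol n M) : Prop :=
  ∀ j : Fin n, ∀ᵐ s ∂(roundsLaw ι.dist),
    Tendsto (fun N : ℕ => ∏ k ∈ Finset.range N, ι.pmax j (pre s k)) atTop (𝓝 0)

end InnocentProtocol

/-- A protocol in infinitely many rounds for leakers and non-leakers: the next message of player
`j` after `s` is chosen from `innocent j s` if `j` is not a leaker, and from `leaker x j s` if `j`
is a leaker and the secret is `x`. -/
structure RoundProtocol (n : ℕ) (𝒳 M : Type*) where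
  innocent : Fin n → List (Fin n → M) → PMF M
  leaker : 𝒳 → Fin n → List (Fin n → M) → PMF M

namespace RoundProtocol

variable {n : ℕ} {𝒳 M : Type*}

/-- The distribution of the next message of player `j` after `s`, given `X = x` and `L = l`. -/
def message (ρ : RoundProtocol n 𝒳 M) (x : 𝒳) (l : Fin n → Bool) (j : Fin n)
    (s : List (Fin n → M)) : PMF M :=
  if l j then ρ.leaker x j s else ρ.innocent j s

/-- `ρ` is built on top of `ι`: non-leakers follow `ι`, and leakers send messages that are
possible in `ι`. -/
structure IsOnTopOf (ρ : RoundProtocol n 𝒳 M) (ι : InnocentProtocol n M) : Prop where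
  innocent_eq : ∀ j s, ρ.innocent j s = ι.dist j s
  leaker_subset : ∀ x j s, (ρ.leaker x j s).support ⊆ ι.msgs j s

variable [Countable 𝒳] [MeasurableSpace 𝒳] [DiscreteMeasurableSpace 𝒳]
  [Countable M] [MeasurableSpace M] [DiscreteMeasurableSpace M]

/-- The conditional law of the infinite transcript of `ρ`, given `(X, L)`. -/
def transcriptKernel (ρ : RoundProtocol n 𝒳 M) :
    Kernel (𝒳 × (Fin n → Bool)) (ℕ → Fin n → M) where
  toFun θ := roundsLaw (ρ.message θ.1 θ.2)
  measurable' := Measurable.of_discrete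

instance (ρ : RoundProtocol n 𝒳 M) : IsMarkovKernel ρ.transcriptKernel :=
  ⟨fun θ => inferInstanceAs (IsProbabilityMeasure (roundsLaw (ρ.message θ.1 θ.2)))⟩

end RoundProtocol

end Cryptogenography

end

/-! The idea is to run `π` inside `ι`. The simulation keeps a partial transcript `t` of `π` and a
law `c`: that of the next partial transcript among innocent players, given what has been sent in `ι`
since `t` was reached. When the sender after `t` sends `m` in `ι`, `c` is written as a mixture of
laws `κ m` with the probabilities of `ι` as weights, and `κ m` replaces `c`. Once `κ m` is a point
mass, the simulation moves on to that transcript.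

To make this happen, the possible continuations of `t` are numbered and `c` is cut into consecutive
intervals (`exists_split`). A given level then separates points of at most one part, so the
probability that it still does so shrinks by `pmax` per round. Informativeness, with a separate
treatment of the tail of high levels, shows that the simulation almost surely never gets stuck
(`measure_stuck_eq_zero`), hence produces a final transcript of `π`.

A leaker tilts the distribution of `ι` by the mean likelihood ratio of `κ m`. Given `(x, l)`, the
transcript `s` of the simulation then has density `likelihood x l (f s)` relative to innocent play,
where `f s` is the final transcript (`roundsLaw_simulation`). The transcript of `π` has density
`likelihood x l` relative to its own innocent law, which is the law of `f` (`map_finalTranscript`).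
Posteriors depend on these densities alone (`samePosteriorLaw_of_withDensity`).

Laws are identified through inequalities: for superharmonic `g`, the mean of `g` under `c` is a
supermartingale, Fatou gives an upper bound, and a probability measure below another equals it.
Non-revealing is what gives the densities total mass one. -/

noncomputable section

namespace Cryptogenography

/-! ### Posteriors and densities -/

/-- If the conditional laws of an observation `s` have densities with respect to a common measure
that are functions of `f s`, then observing `s` is equivalent to observing `f s`. -/
theorem samePosteriorLaw_of_withDensity {Θ S T : Type*} [Countable Θ] [MeasurableSpace Θ]
    [DiscreteMeasurableSpace Θ] [Nonempty Θ] [MeasurableSpace S] [MeasurableSpace T]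
    (ν : Measure Θ) [IsFiniteMeasure ν] (κ : Kernel Θ T) [IsFiniteKernel κ]
    (η : Kernel Θ S) [IsFiniteKernel η] (P : Measure S) [IsFiniteMeasure P]
    {f : S → T} (hf : Measurable f) {g : Θ → T → ENNReal} (hg : ∀ θ, Measurable (g θ))
    (hη : ∀ θ, ν {θ} ≠ 0 → η θ = P.withDensity (g θ ∘ f))
    (hκ : ∀ θ, ν {θ} ≠ 0 → κ θ = (P.map f).withDensity (g θ)) :
    SamePosteriorLaw ν κ η := by
  have hν : ∀ᵐ θ ∂ν, ν {θ} ≠ 0 := by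
    rw [ae_iff_of_countable]; exact fun _ h => h
  have hgm : Measurable fun p : Θ × T => g p.1 p.2 := measurable_from_prod_countable_right hg
  have hgm' : Measurable fun p : T × Θ => g p.2 p.1 := hgm.comp measurable_swap
  have hκi : ∀ φ : T → ENNReal, Measurable φ → ∀ B : Set Θ,
      ∫⁻ θ in B, ∫⁻ t, φ t ∂κ θ ∂ν = ∫⁻ t, φ t * ∫⁻ θ in B, g θ t ∂ν ∂(P.map f) := by
    intro φ hφ B
    have h1 : ∫⁻ θ in B, ∫⁻ t, φ t ∂κ θ ∂ν = ∫⁻ θ in B, ∫⁻ t, g θ t * φ t ∂(P.map f) ∂ν := by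
      refine lintegral_congr_ae (ae_restrict_of_ae ?_)
      filter_upwards [hν] with θ h
      rw [hκ θ h, lintegral_withDensity_eq_lintegral_mul _ (hg θ) hφ]
      rfl
    rw [h1, lintegral_lintegral_swap]
    · refine lintegral_congr fun t => ?_
      rw [← lintegral_const_mul _ Measurable.of_discrete]
      simp_rw [mul_comm]
    · exact (hgm.mul (hφ.comp measurable_snd)).aemeasurable
  have hηi : ∀ φ : S → ENNReal, Measurable φ → ∀ B : Set Θ,
      ∫⁻ θ in B, ∫⁻ s, φ s ∂η θ ∂ν = ∫⁻ s, φ s * ∫⁻ θ in B, g θ (f s) ∂ν ∂P := by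
    intro φ hφ B
    have h1 : ∫⁻ θ in B, ∫⁻ s, φ s ∂η θ ∂ν = ∫⁻ θ in B, ∫⁻ s, g θ (f s) * φ s ∂P ∂ν := by
      refine lintegral_congr_ae (ae_restrict_of_ae ?_)
      filter_upwards [hν] with θ h
      rw [hη θ h, lintegral_withDensity_eq_lintegral_mul _ ((hg θ).comp hf) hφ]
      rfl
    rw [h1, lintegral_lintegral_swap]
    · refine lintegral_congr fun t => ?_
      rw [← lintegral_const_mul _ Measurable.of_discrete]
      simp_rw [mul_comm]
    · exact ((hgm.comp (measurable_fst.prodMk (hf.comp measurable_snd))).mul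
        (hφ.comp measurable_snd)).aemeasurable
  have hmap : (η ∘ₘ ν).map f = κ ∘ₘ ν := by
    ext C hC
    rw [Measure.map_apply hf hC, Measure.bind_apply (hf hC) η.aemeasurable,
      Measure.bind_apply hC κ.aemeasurable]
    refine lintegral_congr_ae ?_
    filter_upwards [hν] with θ h
    rw [hη θ h, hκ θ h, withDensity_apply _ (hf hC), withDensity_apply _ hC,
      setLIntegral_map hC (hg θ) hf]
    rfl
  -- Bayes' formula, multiplied out so that nothing is divided by the total density.
  have hpost : ∀ B : Set Θ,
      (fun t => (∫⁻ θ, g θ t ∂ν) * (κ†ν) t B) =ᵐ[P.map f] fun t => ∫⁻ θ in B, g θ t ∂ν := by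
    intro B
    have hB : MeasurableSet B := MeasurableSet.of_discrete
    have hm1 : Measurable fun t => ∫⁻ θ, g θ t ∂ν := hgm'.lintegral_prod_right'
    have hm2 : Measurable fun t => ∫⁻ θ in B, g θ t ∂ν := hgm'.lintegral_prod_right'
    have hm3 : Measurable fun t => (κ†ν) t B := Kernel.measurable_coe _ hB
    refine ae_eq_of_forall_setLIntegral_eq_of_sigmaFinite (hm1.mul hm3) hm2 fun C hC _ => ?_
    have key := congrArg (fun m => m (C ×ˢ B)) (compProd_posterior_eq_map_swap (κ := κ) (μ := ν))
    rw [Measure.compProd_apply_prod hC hB, Measure.map_apply measurable_swap (hC.prod hB),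
      Set.preimage_swap_prod, Measure.compProd_apply_prod hB hC,
      ← lintegral_indicator hC, Measure.lintegral_bind κ.aemeasurable
        (hm3.indicator hC).aemeasurable] at key
    have e1 := hκi _ (hm3.indicator hC) Set.univ
    have e2 := hκi _ (measurable_one.indicator hC) B
    simp only [Measure.restrict_univ] at e1
    rw [e1] at key
    simp_rw [lintegral_indicator_one hC] at e2
    rw [e2] at key
    rw [← lintegral_indicator hC, ← lintegral_indicator hC]
    convert key using 2 <;> ext t <;> by_cases ht : t ∈ C <;> simp [ht, mul_comm]
  -- The density sees `s` only through `f s`, so the posterior given `s` is that given `f s`.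
  have hcomp : (κ†ν).comap f hf =ᵐ[η ∘ₘ ν] η†ν := by
    refine ae_eq_posterior_of_compProd_eq ?_
    refine Measure.ext_prod fun {A B} hA hB => ?_
    have hm3 : Measurable fun s => (κ†ν) (f s) B := (Kernel.measurable_coe _ hB).comp hf
    rw [Measure.compProd_apply_prod hA hB, Measure.map_apply measurable_swap (hA.prod hB),
      Set.preimage_swap_prod, Measure.compProd_apply_prod hB hA,
      ← lintegral_indicator hA]
    simp only [Kernel.comap_apply]
    rw [Measure.lintegral_bind η.aemeasurable (hm3.indicator hA).aemeasurable]
    have e1 := hηi _ (hm3.indicator hA) Set.univ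
    have e2 := hηi _ (measurable_one.indicator hA) B
    simp only [Measure.restrict_univ] at e1
    rw [e1]
    simp_rw [lintegral_indicator_one hA] at e2
    rw [e2]
    refine lintegral_congr_ae ?_
    filter_upwards [ae_of_ae_map hf.aemeasurable (hpost B)] with s hs
    rw [← hs]
    by_cases h : s ∈ A <;> simp [h, mul_comm]
  unfold SamePosteriorLaw
  rw [← hmap, Measure.map_map (Kernel.measurable _) hf]
  exact Measure.map_congr hcomp

/-! ### Cylinders in the space of transcripts -/

theorem length_pre {R : Type*} (s : ℕ → R) (k : ℕ) : (pre s k).length = k := by simp [pre]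

theorem pre_succ {R : Type*} (s : ℕ → R) (k : ℕ) : pre s (k + 1) = pre s k ++ [s k] := by
  rw [pre, List.ofFn_succ', List.concat_eq_append]; rfl

theorem pre_prefix_pre {R : Type*} (s : ℕ → R) {j k : ℕ} (h : j ≤ k) : pre s j <+: pre s k := by
  induction h with
  | refl => exact List.prefix_refl _
  | step _ ih => rw [pre_succ]; exact ih.trans (List.prefix_append _ _)

/-- The infinite transcripts that extend the partial transcript `s`. -/
def cylinderOf {R : Type*} (s : List R) : Set (ℕ → R) := {ω | pre ω s.length = s}

theorem mem_cylinderOf_append {R : Type*} {s : List R} {r : R} {ω : ℕ → R} :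
    ω ∈ cylinderOf (s ++ [r]) ↔ ω ∈ cylinderOf s ∧ ω s.length = r := by
  simp only [cylinderOf, Set.mem_ofPred_eq, List.length_append, List.length_singleton, pre_succ]
  constructor
  · intro h
    have := List.append_inj h (length_pre _ _)
    simpa using this
  · rintro ⟨h, rfl⟩; rw [h]

section

variable {R : Type*} [Countable R] [MeasurableSpace R] [DiscreteMeasurableSpace R]

theorem measurable_pre (k : ℕ) : Measurable fun s : ℕ → R => pre s k :=
  (Measurable.of_discrete (f := fun h : Fin k → R => List.ofFn h)).comp
    (measurable_pi_lambda _ fun i => measurable_pi_apply (i : ℕ))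

theorem measurable_comp_pre {β : Type*} [MeasurableSpace β] (h : List R → β) (k : ℕ) :
    Measurable fun s : ℕ → R => h (pre s k) :=
  (Measurable.of_discrete (f := h)).comp (measurable_pre k)

theorem measurableSet_cylinderOf (s : List R) : MeasurableSet (cylinderOf s) :=
  measurable_pre s.length (MeasurableSet.of_discrete (s := {s}))

/-- A probability measure on sequences is determined by an upper bound on cylinders. -/
theorem eq_of_cylinderOf_le {P Q : Measure (ℕ → R)} [IsProbabilityMeasure P]
    [IsProbabilityMeasure Q] (h : ∀ s, P (cylinderOf s) ≤ Q (cylinderOf s)) : P = Q := by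
  -- The partial transcripts of length `k` are countably many, and equal total mass turns the bound
  -- on each into equality.
  have hmap : ∀ k, P.map (fun ω => pre ω k) = Q.map (fun ω => pre ω k) := by
    intro k
    have := Measure.isProbabilityMeasure_map (μ := P) (measurable_pre k).aemeasurable
    have := Measure.isProbabilityMeasure_map (μ := Q) (measurable_pre k).aemeasurable
    refine Measure.eq_of_le_of_isProbabilityMeasure (Measure.le_iff.2 fun A hA => ?_)
    rw [← Measure.tsum_indicator_apply_singleton _ _ hA,
      ← Measure.tsum_indicator_apply_singleton _ _ hA]
    refine ENNReal.tsum_le_tsum fun s => Set.indicator_le_indicator ?_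
    rw [Measure.map_apply (measurable_pre k) MeasurableSet.of_discrete,
      Measure.map_apply (measurable_pre k) MeasurableSet.of_discrete]
    by_cases hs : s.length = k
    · subst hs; exact h s
    · have : (fun ω : ℕ → R => pre ω k) ⁻¹' {s} = ∅ := by
        ext ω; simp only [Set.mem_preimage, Set.mem_singleton_iff, Set.mem_empty_iff_false,
          iff_false]
        rintro rfl; exact hs (length_pre _ _)
      simp [this]
  have hproj : ∀ I : Finset ℕ, P.map I.restrict = Q.map I.restrict := by
    intro I
    obtain ⟨k, hk⟩ : ∃ k, ∀ i ∈ I, i < k := ⟨I.sup id + 1, fun i hi =>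
      Nat.lt_succ_of_le (Finset.le_sup (f := id) hi)⟩
    have hne : Nonempty R := by
      obtain ⟨ω⟩ := nonempty_of_isProbabilityMeasure P
      exact ⟨ω 0⟩
    -- Indices in `I` lie below `k`, so the default of `getD` is never used.
    have hI : (I.restrict : (ℕ → R) → (I → R)) =
        (fun (l : List R) (i : I) => l.getD i hne.some) ∘ fun ω => pre ω k := by
      ext ω i
      have := hk i i.2
      simp [pre, this]
    have hm : Measurable fun (l : List R) (i : I) => l.getD i hne.some := Measurable.of_discrete
    rw [hI, ← Measure.map_map hm (measurable_pre k), hmap, Measure.map_map hm (measurable_pre k)]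
  have h1 : IsProjectiveLimit Q (fun I : Finset ℕ => P.map I.restrict) := fun I => (hproj I).symm
  have : ∀ I : Finset ℕ, IsFiniteMeasure (P.map I.restrict) := fun I => by infer_instance
  exact IsProjectiveLimit.unique (P := fun I : Finset ℕ => P.map I.restrict) (fun I => rfl) h1

end

/-! ### Conditioning on the past; supermartingales -/

section

variable {n : ℕ} {M : Type*} [Countable M] [MeasurableSpace M] [DiscreteMeasurableSpace M]
  (d : Fin n → List (Fin n → M) → PMF M)

/-- The tower property for one round. Round `0` is drawn from the initial law rather than from a
kernel, hence the two cases. -/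
theorem lintegral_round (F : List (Fin n → M) → (Fin n → M) → ENNReal) (k : ℕ) :
    ∫⁻ ω, F (pre ω k) (ω k) ∂roundsLaw d =
      ∫⁻ ω, ∫⁻ r, F (pre ω k) r ∂roundLaw d (pre ω k) ∂roundsLaw d := by
  cases k with
  | zero =>
    have h0 : (roundsLaw d).map (fun ω => ω 0) = roundLaw d [] := by
      have h1 : (roundsLaw d).map (Preorder.frestrictLe (π := fun _ => Fin n → M) 0) =
          (roundLaw d []).map (MeasurableEquiv.piUnique
            (fun _ : Finset.Iic 0 => Fin n → M)).symm := by
        unfold roundsLaw Kernel.trajMeasure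
        rw [Measure.map_comp _ _ (by fun_prop), Kernel.traj_map_frestrictLe,
          Kernel.partialTraj_self, Measure.id_comp]
      have h2 := congrArg (Measure.map (fun h : (Finset.Iic 0 → Fin n → M) => h ⟨0, by simp⟩)) h1
      rw [Measure.map_map (by fun_prop) (by fun_prop),
        Measure.map_map (by fun_prop) (by fun_prop)] at h2
      refine h2.trans ?_
      convert Measure.map_id
      ext r : 1
      exact (MeasurableEquiv.piUnique (fun _ : Finset.Iic 0 => Fin n → M)).apply_symm_apply r
    simp only [pre, List.ofFn_zero, lintegral_const, measure_univ, mul_one]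
    rw [← h0, lintegral_map Measurable.of_discrete (by fun_prop)]
  | succ a =>
    have key := Kernel.map_frestrictLe_trajMeasure_compProd_eq_map_trajMeasure
      (X := fun _ => Fin n → M) (μ₀ := roundLaw d []) (κ := roundKernel d) (a := a)
    let T : (Finset.Iic a → Fin n → M) → List (Fin n → M) := fun h =>
      List.ofFn fun i : Fin (a + 1) => h ⟨i, Finset.mem_Iic.2 (Nat.le_of_lt_succ i.2)⟩
    have hT : ∀ ω : ℕ → Fin n → M, T (Preorder.frestrictLe a ω) = pre ω (a + 1) := fun ω => rfl
    have h2 := congrArg (fun m => ∫⁻ p, F (T p.1) p.2 ∂m) key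
    have hm : Measurable fun p : (Finset.Iic a → Fin n → M) × (Fin n → M) => F (T p.1) p.2 :=
      Measurable.of_discrete
    rw [Measure.lintegral_compProd hm, lintegral_map hm (by fun_prop),
      lintegral_map Measurable.of_discrete (by fun_prop)] at h2
    exact h2.symm

theorem roundsLaw_cylinderOf_nil : roundsLaw d (cylinderOf []) = 1 := by
  have : cylinderOf ([] : List (Fin n → M)) = Set.univ := by ext; simp [cylinderOf, pre]
  rw [this, measure_univ]

theorem roundLaw_singleton (s : List (Fin n → M)) (r : Fin n → M) :
    roundLaw d s {r} = ∏ j, d j s (r j) := by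
  rw [roundLaw, Measure.pi_singleton]
  simp [PMF.toMeasure_apply_singleton]

theorem roundsLaw_cylinderOf_append (s : List (Fin n → M)) (r : Fin n → M) :
    roundsLaw d (cylinderOf (s ++ [r])) = roundsLaw d (cylinderOf s) * ∏ j, d j s (r j) := by
  classical
  have h := lintegral_round d (fun s' r' => if s' = s ∧ r' = r then 1 else 0) s.length
  have h1 : ∀ ω : ℕ → Fin n → M, (if pre ω s.length = s ∧ ω s.length = r then (1 : ENNReal) else 0)
      = (cylinderOf (s ++ [r])).indicator 1 ω := by
    intro ω
    simp only [Set.indicator, mem_cylinderOf_append, Pi.one_apply]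
    congr 1
  have h2 : ∀ ω : ℕ → Fin n → M, ∫⁻ r', (if pre ω s.length = s ∧ r' = r then (1 : ENNReal) else 0)
      ∂roundLaw d (pre ω s.length) =
      (cylinderOf s).indicator (fun _ => ∏ j, d j s (r j)) ω := by
    intro ω
    by_cases hω : pre ω s.length = s
    · have hω' : ω ∈ cylinderOf s := hω
      simp only [hω, true_and, Set.indicator_of_mem hω']
      rw [← roundLaw_singleton, ← lintegral_indicator_one MeasurableSet.of_discrete]
      refine lintegral_congr fun r' => ?_
      simp [Set.indicator]
    · have hω' : ω ∉ cylinderOf s := hω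
      simp [hω, hω']
  simp only [h1, h2] at h
  rwa [lintegral_indicator_one (measurableSet_cylinderOf _),
    lintegral_indicator_const (measurableSet_cylinderOf _), mul_comm] at h

/-- Nonnegative supermartingales, after the partial transcript `s`: Fatou's lemma. -/
theorem setLIntegral_liminf_le {h : List (Fin n → M) → ENNReal} {s : List (Fin n → M)}
    (hh : ∀ s', s <+: s' → ∫⁻ r, h (s' ++ [r]) ∂roundLaw d s' ≤ h s') :
    ∫⁻ ω in cylinderOf s, liminf (fun k => h (pre ω k)) atTop ∂roundsLaw d ≤
      roundsLaw d (cylinderOf s) * h s := by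
  classical
  have hk : ∀ k, ∫⁻ ω in cylinderOf s, h (pre ω (s.length + k)) ∂roundsLaw d ≤
      roundsLaw d (cylinderOf s) * h s := by
    intro k
    induction k with
    | zero =>
      refine le_of_eq ?_
      rw [mul_comm, ← setLIntegral_const]
      exact setLIntegral_congr_fun (measurableSet_cylinderOf s) fun ω hω => by
        simp only [add_zero]; rw [show pre ω s.length = s from hω]
    | succ k ih =>
      refine le_trans ?_ ih
      rw [← lintegral_indicator (measurableSet_cylinderOf s),
        ← lintegral_indicator (measurableSet_cylinderOf s)]
      -- From round `s.length` on, membership in the cylinder is decided by the past, so the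
      -- supermartingale inequality may be integrated over it.
      have hcyl : ∀ ω : ℕ → Fin n → M, ω ∈ cylinderOf s ↔ s <+: pre ω (s.length + k) := by
        intro ω
        constructor
        · intro hω
          have := pre_prefix_pre ω (Nat.le_add_right s.length k)
          rwa [show pre ω s.length = s from hω] at this
        · intro hω
          have := List.prefix_of_prefix_length_le hω
            (pre_prefix_pre ω (Nat.le_add_right s.length k)) (by simp [length_pre])
          exact (this.eq_of_length (by simp [length_pre])).symm
      have := lintegral_round d (fun s' r => if s <+: s' then h (s' ++ [r]) else 0) (s.length + k)
      calc _ = ∫⁻ ω, (if s <+: pre ω (s.length + k) then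
              h (pre ω (s.length + k) ++ [ω (s.length + k)]) else 0) ∂roundsLaw d := by
            refine lintegral_congr fun ω => ?_
            simp only [Set.indicator, hcyl, ← pre_succ, add_assoc]
        _ = _ := this
        _ ≤ _ := by
            refine lintegral_mono fun ω => ?_
            simp only [Set.indicator, hcyl]
            split_ifs with hs
            · exact hh _ hs
            · simp
  calc _ ≤ liminf (fun k => ∫⁻ ω in cylinderOf s, h (pre ω k) ∂roundsLaw d) atTop :=
        lintegral_liminf_le fun k => measurable_comp_pre h k
    _ ≤ _ := by
        refine liminf_le_of_frequently_le' ?_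
        refine Eventually.frequently (eventually_atTop.2 ⟨s.length, fun k hkl => ?_⟩)
        obtain ⟨k, rfl⟩ := Nat.exists_eq_add_of_le hkl
        exact hk k

theorem lintegral_roundLaw_eval (s : List (Fin n → M)) (j : Fin n) (φ : M → ENNReal) :
    ∫⁻ r, φ (r j) ∂roundLaw d s = ∑' m, d j s m * φ m := by
  have h := lintegral_map (μ := roundLaw d s) (f := φ) (g := fun r => r j)
    Measurable.of_discrete (by fun_prop)
  rw [← h, roundLaw, (measurePreserving_eval (fun j => (d j s).toMeasure) j).map_eq, lintegral_countable']
  simp [PMF.toMeasure_apply_singleton, mul_comm]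

end

/-! ### Cutting a distribution into intervals -/

section Splitting

variable {α M : Type*}

/-- The weights `c` charge points of level at most `i` and points of level above `i`. -/
def Straddles (e : α → ℕ) (i : ℕ) (c : α → ENNReal) : Prop :=
  (∃ a, c a ≠ 0 ∧ e a ≤ i) ∧ ∃ a, c a ≠ 0 ∧ i < e a

theorem Straddles.mono {e : α → ℕ} {i : ℕ} {c d : α → ENNReal} (h : Straddles e i d)
    (hdc : ∀ a, d a ≠ 0 → c a ≠ 0) : Straddles e i c :=
  ⟨h.1.imp fun a ha => ⟨hdc a ha.1, ha.2⟩, h.2.imp fun a ha => ⟨hdc a ha.1, ha.2⟩⟩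

/-- Weights can be cut in two parts of prescribed masses, one below the other. -/
theorem exists_cut (e : α → ℕ) (c : α → ENNReal) (hc : ∑' a, c a ≠ ⊤) {w : ENNReal}
    (hw : w ≤ ∑' a, c a) :
    ∃ d d' : α → ENNReal, (∀ a, d a + d' a = c a) ∧ ∑' a, d a = w ∧
      ∀ i, ¬ Straddles e i d ∨ ¬ Straddles e i d' := by
  classical
  rcases hw.eq_or_lt with rfl | hlt
  · exact ⟨c, 0, by simp, rfl, fun i => Or.inr (by simp [Straddles])⟩
  let C : ℕ → ENNReal := fun N => ∑' a, if e a < N then c a else 0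
  have hex : ∃ N, w < C N := by
    rw [ENNReal.tsum_eq_iSup_sum, lt_iSup_iff] at hlt
    obtain ⟨s, hs⟩ := hlt
    refine ⟨s.sup e + 1, hs.trans_le ?_⟩
    refine le_trans (Finset.sum_le_sum fun a ha => ?_) (ENNReal.sum_le_tsum s)
    rw [if_pos (Nat.lt_succ_of_le (Finset.le_sup ha))]
  -- Level `i₀` is where the cumulative mass first exceeds `w`: `C i₀ ≤ w < C (i₀ + 1)`.
  obtain ⟨i₀, hi₀⟩ : ∃ i, Nat.find hex = i + 1 := by
    refine Nat.exists_eq_succ_of_ne_zero fun h => ?_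
    have := Nat.find_spec hex
    rw [h] at this
    simp [C] at this
  have h1 : w < C (i₀ + 1) := hi₀ ▸ Nat.find_spec hex
  have h2 : C i₀ ≤ w := not_lt.1 (Nat.find_min hex (by omega))
  let l : ENNReal := ∑' a, if e a = i₀ then c a else 0
  have h3 : C (i₀ + 1) = C i₀ + l := by
    rw [← ENNReal.tsum_add]
    refine tsum_congr fun a => ?_
    rcases lt_trichotomy (e a) i₀ with h | h | h
    · simp [h, h.ne, Nat.lt_succ_of_lt h]
    · simp [h]
    · simp [h.not_gt, h.ne', show ¬ e a < i₀ + 1 by omega]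
  have hl : l ≠ ⊤ := ne_top_of_le_ne_top hc (ENNReal.tsum_le_tsum fun a => by split_ifs <;> simp)
  have hl0 : l ≠ 0 := by
    intro h; rw [h3, h, add_zero] at h1; exact absurd h1 h2.not_gt
  -- The share of level `i₀` that must go to the lower part to bring its mass up to `w`.
  let q : ENNReal := (w - C i₀) / l
  have hq : q * l = w - C i₀ := ENNReal.div_mul_cancel hl0 hl
  have hq1 : q ≤ 1 := by
    refine ENNReal.div_le_of_le_mul ?_
    rw [one_mul]; exact tsub_le_iff_left.2 (h3 ▸ h1.le)
  refine ⟨fun a => (if e a < i₀ then c a else 0) + q * (if e a = i₀ then c a else 0),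
    fun a => (if i₀ < e a then c a else 0) + (1 - q) * (if e a = i₀ then c a else 0), ?_, ?_, ?_⟩
  · intro a
    rcases lt_trichotomy (e a) i₀ with h | h | h
    · simp [h, h.ne, h.not_gt]
    · simp only [h, lt_irrefl, if_false, if_true, zero_add, ← add_mul, add_tsub_cancel_of_le hq1,
        one_mul]
    · simp [h, h.ne', h.not_gt]
  · rw [ENNReal.tsum_add, ENNReal.tsum_mul_left]
    change C i₀ + q * l = w
    rw [hq, add_tsub_cancel_of_le h2]
  -- The lower part lives on levels `≤ i₀`, the upper one on levels `≥ i₀`; no `i` can separate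
  -- points of both.
  · intro i
    rcases lt_or_ge i i₀ with hi | hi
    · refine Or.inr fun h => ?_
      obtain ⟨a, ha, hai⟩ := h.1
      have h4 : e a < i₀ := by omega
      simp [h4.ne, h4.not_gt] at ha
    · refine Or.inl fun h => ?_
      obtain ⟨a, ha, hai⟩ := h.2
      have h4 : i₀ < e a := by omega
      simp [h4.ne', h4.not_gt] at ha

/-- Weights can be cut in consecutive parts of prescribed masses. -/
theorem exists_cuts (e : α → ℕ) (w : M → ENNReal) (S : Finset M) (c : α → ENNReal)
    (hc : ∑' a, c a = ∑ m ∈ S, w m) (hfin : ∑ m ∈ S, w m ≠ ⊤) :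
    ∃ D : M → α → ENNReal, (∀ m ∈ S, ∑' a, D m a = w m) ∧ (∀ a, ∑ m ∈ S, D m a = c a) ∧
      ∀ i, ∀ m ∈ S, ∀ m' ∈ S, Straddles e i (D m) → Straddles e i (D m') → m = m' := by
  classical
  induction S using Finset.induction_on generalizing c with
  | empty =>
    refine ⟨fun _ _ => 0, by simp, fun a => ?_, by simp⟩
    simp only [Finset.sum_empty, ENNReal.tsum_eq_zero] at hc ⊢
    exact (hc a).symm
  | insert m₀ S hm ih =>
    rw [Finset.sum_insert hm] at hc hfin
    have hw0 : w m₀ ≠ ⊤ := fun h => hfin (by simp [h])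
    have hwS : ∑ m ∈ S, w m ≠ ⊤ := fun h => hfin (by simp [h])
    obtain ⟨d, d', hdd, hd, hs⟩ := exists_cut e c (hc ▸ hfin) (w := w m₀) (hc ▸ le_self_add)
    have hd' : ∑' a, d' a = ∑ m ∈ S, w m := by
      have : ∑' a, d a + ∑' a, d' a = w m₀ + ∑ m ∈ S, w m := by
        rw [← ENNReal.tsum_add, ← hc]; exact tsum_congr hdd
      rw [hd] at this
      exact (ENNReal.add_right_inj hw0).1 this
    obtain ⟨D, hD1, hD2, hD3⟩ := ih d' hd' hwS
    have hne : ∀ m ∈ S, m ≠ m₀ := fun m h h' => hm (h' ▸ h)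
    -- The later parts lie inside `d'`, so they straddle no level that `d` straddles.
    have hsub : ∀ m ∈ S, ∀ i, Straddles e i (D m) → Straddles e i d' := fun m h i hi =>
      hi.mono fun a ha h0 => ha (Finset.sum_eq_zero_iff.1 ((hD2 a).trans h0) m h)
    refine ⟨Function.update D m₀ d, ?_, ?_, ?_⟩
    · intro m h
      rcases Finset.mem_insert.1 h with rfl | h
      · simpa using hd
      · rw [Function.update_of_ne (hne m h)]; exact hD1 m h
    · intro a
      rw [Finset.sum_insert hm, Function.update_self, ← hdd a, ← hD2 a]
      congr 1
      exact Finset.sum_congr rfl fun m h => by rw [Function.update_of_ne (hne m h)]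
    · intro i m h m' h' hi hi'
      rcases Finset.mem_insert.1 h with rfl | k <;> rcases Finset.mem_insert.1 h' with rfl | k'
      · rfl
      · rw [Function.update_self] at hi
        rw [Function.update_of_ne (hne m' k')] at hi'
        exact ((hs i).elim (· hi) (· (hsub m' k' i hi'))).elim
      · rw [Function.update_self] at hi'
        rw [Function.update_of_ne (hne m k)] at hi
        exact ((hs i).elim (· hi') (· (hsub m k i hi))).elim
      · rw [Function.update_of_ne (hne m k)] at hi
        rw [Function.update_of_ne (hne m' k')] at hi'
        exact hD3 i m k m' k' hi hi'

/-- A distribution `c` is a mixture, with finitely many given weights, of distributions such that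
each level separates the points charged by at most one of them. -/
theorem exists_split (e : α → ℕ) (P : PMF M) (S : Finset M) (hP : P.support ⊆ S) (c : PMF α) :
    ∃ κ : M → PMF α, (∀ a, ∑' m, P m * κ m a = c a) ∧ (∀ m, (κ m).support ⊆ c.support) ∧
      ∀ i m m', P m ≠ 0 → P m' ≠ 0 → Straddles e i (κ m) → Straddles e i (κ m') → m = m' := by
  classical
  have hPS : ∀ m ∉ S, P m = 0 := fun m hm => by
    by_contra h; exact hm (hP ((P.mem_support_iff m).2 h))
  have hS : ∑ m ∈ S, P m = 1 := by rw [← P.tsum_coe, tsum_eq_sum fun m hm => hPS m hm]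
  obtain ⟨D, hD1, hD2, hD3⟩ := exists_cuts e P S c (by rw [c.tsum_coe, hS]) (by simp [hS])
  have hmem : ∀ m, P m ≠ 0 → m ∈ S := fun m h => by
    by_contra h'; exact h (hPS m h')
  have hDc : ∀ m ∈ S, ∀ a, D m a ≠ 0 → c a ≠ 0 := fun m hm a ha h0 =>
    ha (Finset.sum_eq_zero_iff.1 ((hD2 a).trans h0) m hm)
  -- For messages of probability zero any law supported in that of `c` would do.
  let κ : M → PMF α := fun m => if h : P m ≠ 0 then
    ⟨fun a => (P m)⁻¹ * D m a, by
      have : ∑' a, (P m)⁻¹ * D m a = 1 := by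
        rw [ENNReal.tsum_mul_left, hD1 m (hmem m h), ENNReal.inv_mul_cancel h (P.apply_ne_top m)]
      exact this ▸ ENNReal.summable.hasSum⟩ else c
  have hκ : ∀ m, P m ≠ 0 → ∀ a, κ m a = (P m)⁻¹ * D m a := fun m h a => by
    rw [show κ m = _ from dif_pos h]; rfl
  have hκD : ∀ m, P m ≠ 0 → ∀ a, κ m a ≠ 0 → D m a ≠ 0 := fun m h a ha h0 =>
    ha (by rw [hκ m h, h0, mul_zero])
  refine ⟨κ, fun a => ?_, fun m a ha => ?_, fun i m m' h h' hi hi' => ?_⟩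
  · rw [← hD2 a, tsum_eq_sum (s := S) fun m hm => by rw [hPS m hm, zero_mul]]
    refine Finset.sum_congr rfl fun m hm => ?_
    by_cases h : P m = 0
    · have := hD1 m hm
      rw [h, ENNReal.tsum_eq_zero] at this
      rw [h, this a, zero_mul]
    · rw [hκ m h, ← mul_assoc, ENNReal.mul_inv_cancel h (P.apply_ne_top m), one_mul]
  · rw [PMF.mem_support_iff] at ha ⊢
    by_cases h : P m = 0
    · simpa [κ, h] using ha
    · exact hDc m (hmem m h) a (hκD m h a ha)
  · exact hD3 i m (hmem m h) m' (hmem m' h') (hi.mono (hκD m h)) (hi'.mono (hκD m' h'))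

end Splitting

/-! ### Means under discrete distributions -/

/-- The mean of `φ` under `c`. -/
def mean {α : Type*} (c : PMF α) (φ : α → ENNReal) : ENNReal := ∑' a, c a * φ a

section Mean

variable {α β M : Type*}

theorem mean_pure (a : α) (φ : α → ENNReal) : mean (PMF.pure a) φ = φ a := by
  rw [mean, tsum_eq_single a fun b hb => by simp [PMF.pure_apply, hb]]
  simp

theorem mean_congr {c : PMF α} {φ ψ : α → ENNReal} (h : ∀ a ∈ c.support, φ a = ψ a) :
    mean c φ = mean c ψ := by
  refine tsum_congr fun a => ?_
  by_cases ha : c a = 0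
  · simp [ha]
  · rw [h a ((c.mem_support_iff a).2 ha)]

theorem mean_const_mul (c : PMF α) (q : ENNReal) (φ : α → ENNReal) :
    mean c (fun a => q * φ a) = q * mean c φ := by
  rw [mean, mean, ← ENNReal.tsum_mul_left]
  exact tsum_congr fun a => by ring

theorem mean_const (c : PMF α) (q : ENNReal) : mean c (fun _ => q) = q := by
  rw [mean, ENNReal.tsum_mul_right, c.tsum_coe, one_mul]

theorem mean_mean {P : PMF M} {κ : M → PMF α} {c : PMF α}
    (h : ∀ a, ∑' m, P m * κ m a = c a) (φ : α → ENNReal) :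
    ∑' m, P m * mean (κ m) φ = mean c φ := by
  simp only [mean, ← h, ← ENNReal.tsum_mul_left, ← ENNReal.tsum_mul_right]
  rw [ENNReal.tsum_comm]
  exact tsum_congr fun a => tsum_congr fun m => by ring

theorem eq_pure_of_support_subset {c : PMF α} {a : α} (h : c.support ⊆ {a}) : c = PMF.pure a := by
  have h0 : ∀ b, b ≠ a → c b = 0 := fun b hb => by
    by_contra h'; exact hb (h ((c.mem_support_iff b).2 h'))
  ext b
  by_cases hb : b = a
  · have h1 := c.tsum_coe
    rw [tsum_eq_single a h0] at h1
    rw [hb, h1]; simp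
  · rw [h0 b hb, PMF.pure_apply, if_neg hb]

end Mean

/-! ### Innocent steps of `π` and the numbering of their outcomes -/

namespace CollabProtocol

variable {n : ℕ} {𝒳 𝒜 : Type*} (π : CollabProtocol n 𝒳 𝒜)

/-- The distribution of the next partial transcript after `t`, if nobody is a leaker. -/
def innocentStep (t : List 𝒜) : PMF (List 𝒜) :=
  match π.next t with
  | none => PMF.pure t
  | some τ => τ.innocent.map fun a => t ++ [a]

theorem innocentStep_of_none {π : CollabProtocol n 𝒳 𝒜} {t : List 𝒜} (h : π.next t = none) :
    π.innocentStep t = PMF.pure t := by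
  rw [innocentStep, h]

theorem innocentStep_of_some {π : CollabProtocol n 𝒳 𝒜} {t : List 𝒜} {τ : Turn n 𝒳 𝒜}
    (h : π.next t = some τ) : π.innocentStep t = τ.innocent.map fun a => t ++ [a] := by
  rw [innocentStep, h]

theorem exists_of_mem_support_innocentStep {π : CollabProtocol n 𝒳 𝒜} {t v : List 𝒜}
    {τ : Turn n 𝒳 𝒜} (h : π.next t = some τ) (hv : v ∈ (π.innocentStep t).support) :
    ∃ a, v = t ++ [a] := by
  rw [innocentStep_of_some h, PMF.mem_support_map_iff] at hv
  obtain ⟨a, _, rfl⟩ := hv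
  exact ⟨a, rfl⟩

theorem exists_level (t : List 𝒜) :
    ∃ e : List 𝒜 → ℕ, Set.InjOn e (π.innocentStep t).support :=
  Set.countable_iff_exists_injOn.1 (PMF.support_countable _)

/-- A numbering of the possible next partial transcripts. -/
def level (t : List 𝒜) : List 𝒜 → ℕ := (π.exists_level t).choose

theorem level_injOn (t : List 𝒜) : Set.InjOn (π.level t) (π.innocentStep t).support :=
  (π.exists_level t).choose_spec

end CollabProtocol

/-! ### The state of the simulation -/

section Simulation

variable {n : ℕ} {𝒳 𝒜 M : Type*} (π : CollabProtocol n 𝒳 𝒜) (ι : InnocentProtocol n M)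

theorem exists_splitting (j : Fin n) (s : List (Fin n → M)) (t : List 𝒜) (c : PMF (List 𝒜)) :
    ∃ κ : M → PMF (List 𝒜), (∀ v, ∑' m, ι.dist j s m * κ m v = c v) ∧
      (∀ m, (κ m).support ⊆ c.support) ∧
      ∀ i m m', ι.dist j s m ≠ 0 → ι.dist j s m' ≠ 0 → Straddles (π.level t) i (κ m) →
        Straddles (π.level t) i (κ m') → m = m' :=
  exists_split (π.level t) (ι.dist j s) (ι.msgs j s) (ι.support_subset j s) c

/-- The conditional distribution of the next partial transcript of `π`, given the message that
player `j` sends after `s`, if the distribution before this message is `c`. -/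
def splitting (j : Fin n) (s : List (Fin n → M)) (t : List 𝒜) (c : PMF (List 𝒜)) :
    M → PMF (List 𝒜) := (exists_splitting π ι j s t c).choose

theorem mean_splitting (j : Fin n) (s : List (Fin n → M)) (t : List 𝒜) (c : PMF (List 𝒜))
    (φ : List 𝒜 → ENNReal) :
    ∑' m, ι.dist j s m * mean (splitting π ι j s t c m) φ = mean c φ :=
  mean_mean (exists_splitting π ι j s t c).choose_spec.1 φ

theorem support_splitting_subset (j : Fin n) (s : List (Fin n → M)) (t : List 𝒜)
    (c : PMF (List 𝒜)) (m : M) : (splitting π ι j s t c m).support ⊆ c.support :=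
  (exists_splitting π ι j s t c).choose_spec.2.1 m

theorem splitting_unique (j : Fin n) (s : List (Fin n → M)) (t : List 𝒜) (c : PMF (List 𝒜))
    {i : ℕ} {m m' : M} : ι.dist j s m ≠ 0 → ι.dist j s m' ≠ 0 →
    Straddles (π.level t) i (splitting π ι j s t c m) →
    Straddles (π.level t) i (splitting π ι j s t c m') → m = m' :=
  (exists_splitting π ι j s t c).choose_spec.2.2 i m m'

open Classical in
/-- The simulation of `π` keeps track of the partial transcript of `π` and of the conditional
distribution of the next partial transcript. This is its state after the round `r`, if the state
after `s` is `σ`. -/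
def nextState (s : List (Fin n → M)) (σ : List 𝒜 × PMF (List 𝒜)) (r : Fin n → M) :
    List 𝒜 × PMF (List 𝒜) :=
  match π.next σ.1 with
  | none => σ
  | some τ =>
    -- A point mass means that the next message of `π` is decided: commit to it and start on the
    -- following one.
    if h : ∃ v, splitting π ι τ.player s σ.1 σ.2 (r τ.player) = PMF.pure v then
      (h.choose, π.innocentStep h.choose)
    else (σ.1, splitting π ι τ.player s σ.1 σ.2 (r τ.player))

/-- The state of the simulation after the partial transcript `s`. -/
def state (s : List (Fin n → M)) : List 𝒜 × PMF (List 𝒜) :=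
  List.reverseRecOn s ([], π.innocentStep []) fun s r σ => nextState π ι s σ r

theorem state_nil : state π ι [] = ([], π.innocentStep []) :=
  List.reverseRecOn_nil (motive := fun _ => List 𝒜 × PMF (List 𝒜)) ..

theorem state_append (s : List (Fin n → M)) (r : Fin n → M) :
    state π ι (s ++ [r]) = nextState π ι s (state π ι s) r :=
  List.reverseRecOn_concat (motive := fun _ => List 𝒜 × PMF (List 𝒜)) ..

variable {π ι}

theorem state_append_of_none {s : List (Fin n → M)} (h : π.next (state π ι s).1 = none)
    (r : Fin n → M) : state π ι (s ++ [r]) = state π ι s := by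
  rw [state_append, nextState, h]

theorem state_append_of_pure {s : List (Fin n → M)} {τ : Turn n 𝒳 𝒜}
    (h : π.next (state π ι s).1 = some τ) {r : Fin n → M} {v : List 𝒜}
    (hv : splitting π ι τ.player s (state π ι s).1 (state π ι s).2 (r τ.player) = PMF.pure v) :
    state π ι (s ++ [r]) = (v, π.innocentStep v) := by
  have hex : ∃ v, splitting π ι τ.player s (state π ι s).1 (state π ι s).2 (r τ.player) =
    PMF.pure v := ⟨v, hv⟩
  have hv' : hex.choose = v := by
    have h1 := hex.choose_spec.symm.trans hv
    have h2 := congrArg PMF.support h1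
    rwa [PMF.support_pure, PMF.support_pure, Set.singleton_eq_singleton_iff] at h2
  rw [state_append, nextState, h]
  simp only
  rw [dif_pos hex, hv']

theorem state_append_of_not_pure {s : List (Fin n → M)} {τ : Turn n 𝒳 𝒜}
    (h : π.next (state π ι s).1 = some τ) {r : Fin n → M}
    (hv : ¬ ∃ v, splitting π ι τ.player s (state π ι s).1 (state π ι s).2 (r τ.player) =
      PMF.pure v) :
    state π ι (s ++ [r]) = ((state π ι s).1,
      splitting π ι τ.player s (state π ι s).1 (state π ι s).2 (r τ.player)) := by
  rw [state_append, nextState, h]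
  simp only
  rw [dif_neg hv]

/-- Splitting only shrinks supports, and a commitment resets the law to a full innocent step. -/
theorem support_state_subset (s : List (Fin n → M)) :
    (state π ι s).2.support ⊆ (π.innocentStep (state π ι s).1).support := by
  induction s using List.reverseRecOn with
  | nil => rw [state_nil]
  | append_singleton s r ih =>
    cases h : π.next (state π ι s).1 with
    | none => rw [state_append_of_none h]; exact ih
    | some τ =>
      by_cases hv : ∃ v, splitting π ι τ.player s (state π ι s).1 (state π ι s).2 (r τ.player) =
        PMF.pure v
      · obtain ⟨v, hv⟩ := hv
        rw [state_append_of_pure h hv]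
      · rw [state_append_of_not_pure h hv]
        exact (support_splitting_subset ..).trans ih

theorem mem_support_of_pure {s : List (Fin n → M)} {j : Fin n} {m : M} {v : List 𝒜}
    (hv : splitting π ι j s (state π ι s).1 (state π ι s).2 m = PMF.pure v) :
    v ∈ (π.innocentStep (state π ι s).1).support :=
  support_state_subset s (support_splitting_subset π ι j s _ _ m (by rw [hv]; simp))

theorem state_snd_of_none {s : List (Fin n → M)} (h : π.next (state π ι s).1 = none) :
    (state π ι s).2 = PMF.pure (state π ι s).1 := by
  refine eq_pure_of_support_subset ?_
  have := support_state_subset (π := π) (ι := ι) s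
  rwa [CollabProtocol.innocentStep_of_none h, PMF.support_pure] at this

/-- Each round changes the transcript of `π` by at most one message. -/
theorem state_fst_append (s : List (Fin n → M)) (r : Fin n → M) :
    (state π ι (s ++ [r])).1 = (state π ι s).1 ∨
      ∃ a, (state π ι (s ++ [r])).1 = (state π ι s).1 ++ [a] := by
  cases h : π.next (state π ι s).1 with
  | none => rw [state_append_of_none h]; exact Or.inl rfl
  | some τ =>
    by_cases hv : ∃ v, splitting π ι τ.player s (state π ι s).1 (state π ι s).2 (r τ.player) =
      PMF.pure v
    · obtain ⟨v, hv⟩ := hv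
      rw [state_append_of_pure h hv]
      exact Or.inr (CollabProtocol.exists_of_mem_support_innocentStep h (mem_support_of_pure hv))
    · rw [state_append_of_not_pure h hv]
      exact Or.inl rfl

theorem state_fst_prefix {s s' : List (Fin n → M)} (h : s <+: s') :
    (state π ι s).1 <+: (state π ι s').1 := by
  induction s' using List.reverseRecOn with
  | nil => rw [List.prefix_nil.1 h]
  | append_singleton s' r ih =>
    rcases List.prefix_concat_iff.1 h with rfl | h
    · exact List.prefix_refl _
    · refine (ih h).trans ?_
      rcases state_fst_append (π := π) (ι := ι) s' r with h | ⟨a, h⟩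
      · rw [h]
      · rw [h]; exact List.prefix_append _ _

/-- `g` does not increase in the mean, when innocent players communicate by `π`. -/
def Superharmonic (π : CollabProtocol n 𝒳 𝒜) (g : List 𝒜 → ENNReal) : Prop :=
  ∀ t, mean (π.innocentStep t) g ≤ g t

/-- Equality unless the simulation commits; then the point mass at `v` becomes `π.innocentStep v`,
and superharmonicity applies. -/
theorem mean_state_append_le {g : List 𝒜 → ENNReal} (hg : Superharmonic π g)
    {s : List (Fin n → M)} {τ : Turn n 𝒳 𝒜} (h : π.next (state π ι s).1 = some τ)
    (r : Fin n → M) :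
    mean (state π ι (s ++ [r])).2 g ≤
      mean (splitting π ι τ.player s (state π ι s).1 (state π ι s).2 (r τ.player)) g := by
  by_cases hv : ∃ v, splitting π ι τ.player s (state π ι s).1 (state π ι s).2 (r τ.player) =
    PMF.pure v
  · obtain ⟨v, hv⟩ := hv
    rw [state_append_of_pure h hv, hv, mean_pure]
    exact hg v
  · rw [state_append_of_not_pure h hv]

/-- The parts of a splitting average to the law that was split, so the mean of `g` is a
supermartingale under innocent play. -/
theorem lintegral_mean_state_append_le [Countable M] [MeasurableSpace M]
    [DiscreteMeasurableSpace M] {g : List 𝒜 → ENNReal} (hg : Superharmonic π g)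
    (s : List (Fin n → M)) :
    ∫⁻ r, mean (state π ι (s ++ [r])).2 g ∂roundLaw ι.dist s ≤ mean (state π ι s).2 g := by
  cases h : π.next (state π ι s).1 with
  | none => simp [state_append_of_none h]
  | some τ =>
    refine (lintegral_mono fun r => mean_state_append_le hg h r).trans ?_
    rw [lintegral_roundLaw_eval ι.dist s τ.player fun m =>
      mean (splitting π ι τ.player s (state π ι s).1 (state π ι s).2 m) g, mean_splitting]

end Simulation

/-! ### The simulation almost surely stops -/

section Termination

variable {n : ℕ} {𝒳 𝒜 M : Type*} {π : CollabProtocol n 𝒳 𝒜} {ι : InnocentProtocol n M}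

theorem InnocentProtocol.dist_le_pmax (ι : InnocentProtocol n M) (j : Fin n)
    (s : List (Fin n → M)) (m : M) : ι.dist j s m ≤ ι.pmax j s := by
  by_cases h : ι.dist j s m = 0
  · simp [h]
  · exact Finset.le_sup (ι.support_subset j s ((PMF.mem_support_iff _ _).2 h))

theorem InnocentProtocol.pmax_ne_zero (ι : InnocentProtocol n M) (j : Fin n)
    (s : List (Fin n → M)) : ι.pmax j s ≠ 0 := by
  obtain ⟨m, hm⟩ := (ι.dist j s).support_nonempty
  intro h
  exact (PMF.mem_support_iff _ _).1 hm (le_zero_iff.1 (h ▸ ι.dist_le_pmax j s m))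

theorem InnocentProtocol.pmax_ne_top (ι : InnocentProtocol n M) (j : Fin n)
    (s : List (Fin n → M)) : ι.pmax j s ≠ ⊤ :=
  ne_top_of_le_ne_top ENNReal.one_ne_top (Finset.sup_le fun _ _ => PMF.coe_le_one _ _)

/-- The product of the largest probabilities of the messages of player `j` in the rounds `s`. -/
def InnocentProtocol.pmaxProd (ι : InnocentProtocol n M) (j : Fin n) (s : List (Fin n → M)) :
    ENNReal := ∏ k ∈ Finset.range s.length, ι.pmax j (s.take k)

theorem InnocentProtocol.pmaxProd_append (ι : InnocentProtocol n M) (j : Fin n)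
    (s : List (Fin n → M)) (r : Fin n → M) :
    ι.pmaxProd j (s ++ [r]) = ι.pmaxProd j s * ι.pmax j s := by
  rw [pmaxProd, pmaxProd, List.length_append, List.length_singleton, Finset.prod_range_succ,
    List.take_left]
  congr 1
  refine Finset.prod_congr rfl fun k hk => ?_
  rw [List.take_append_of_le_length (Finset.mem_range.1 hk).le]

theorem InnocentProtocol.pmaxProd_pre (ι : InnocentProtocol n M) (j : Fin n)
    (ω : ℕ → Fin n → M) (k : ℕ) :
    ι.pmaxProd j (pre ω k) = ∏ i ∈ Finset.range k, ι.pmax j (pre ω i) := by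
  induction k with
  | zero => simp [pmaxProd, pre]
  | succ k ih => rw [pre_succ, pmaxProd_append, ih, Finset.prod_range_succ]

theorem InnocentProtocol.pmaxProd_ne_zero (ι : InnocentProtocol n M) (j : Fin n)
    (s : List (Fin n → M)) : ι.pmaxProd j s ≠ 0 :=
  Finset.prod_ne_zero_iff.2 fun _ _ => ι.pmax_ne_zero j _

theorem InnocentProtocol.pmaxProd_ne_top (ι : InnocentProtocol n M) (j : Fin n)
    (s : List (Fin n → M)) : ι.pmaxProd j s ≠ ⊤ :=
  ENNReal.prod_ne_top fun _ _ => ι.pmax_ne_top j _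

-- At most one possible message leaves level `i` straddled, and its probability is at most `pmax`.
open Classical in
theorem tsum_straddles_splitting_le (j : Fin n) (s : List (Fin n → M)) (t : List 𝒜)
    (c : PMF (List 𝒜)) (i : ℕ) (q : ENNReal) :
    ∑' m, ι.dist j s m * (if Straddles (π.level t) i (splitting π ι j s t c m) then q else 0) ≤
      ι.pmax j s * if Straddles (π.level t) i c then q else 0 := by
  by_cases h : ∃ m, ι.dist j s m ≠ 0 ∧ Straddles (π.level t) i (splitting π ι j s t c m)
  · obtain ⟨m, hm, hs⟩ := h
    rw [tsum_eq_single m fun m' hm' => ?_, if_pos hs, if_pos (hs.mono fun v hv => ?_)]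
    · gcongr; exact ι.dist_le_pmax j s m
    · exact (PMF.mem_support_iff _ _).1 (support_splitting_subset π ι j s t c m
        ((PMF.mem_support_iff _ _).2 hv))
    · by_cases h0 : ι.dist j s m' = 0
      · rw [h0, zero_mul]
      · rw [if_neg fun hs' => hm' (splitting_unique π ι j s t c h0 hm hs' hs), mul_zero]
  · have : ∀ m, ι.dist j s m * (if Straddles (π.level t) i (splitting π ι j s t c m) then q else 0)
        = 0 := by
      intro m
      by_cases h0 : ι.dist j s m = 0
      · rw [h0, zero_mul]
      · rw [if_neg fun hs => h ⟨m, h0, hs⟩, mul_zero]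
    simp [this]

variable (π ι) in
open Classical in
/-- A supermartingale that is eventually at least `1`, if the simulation stays at `t` forever. -/
def potential (t : List 𝒜) (j : Fin n) (N : ℕ) (δ : ENNReal) (s : List (Fin n → M)) : ENNReal :=
  if (state π ι s).1 = t then
    -- The mean pays for the levels from `N` on. Each lower level is paid for by a term that grows
    -- by the factor `1 / pmax` in every round that leaves it straddled.
    mean (state π ι s).2 (fun v => if N ≤ π.level t v then 1 else 0) +
      ∑ i ∈ Finset.range N, if Straddles (π.level t) i (state π ι s).2 then
        δ / ι.pmaxProd j s else 0
  else 0

/-- The tail term is preserved by averaging. In the others, the decrease of the straddling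
probability makes up for the extra `pmax` in the denominator. Leaving `t` makes the potential zero
for good, since the simulated transcript only grows. -/
theorem lintegral_potential_append_le [Countable M] [MeasurableSpace M]
    [DiscreteMeasurableSpace M] {s₀ s : List (Fin n → M)} {τ : Turn n 𝒳 𝒜}
    (hτ : π.next (state π ι s₀).1 = some τ) (N : ℕ) (δ : ENNReal) (hs : s₀ <+: s) :
    ∫⁻ r, potential π ι (state π ι s₀).1 τ.player N δ (s ++ [r]) ∂roundLaw ι.dist s ≤
      potential π ι (state π ι s₀).1 τ.player N δ s := by
  classical
  generalize ht : (state π ι s₀).1 = t at hτ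
  by_cases h : (state π ι s).1 = t
  · have hτ' : π.next (state π ι s).1 = some τ := h ▸ hτ
    set c := (state π ι s).2 with hc
    set j := τ.player
    let φ : M → ENNReal := fun m =>
      mean (splitting π ι j s t c m) (fun v => if N ≤ π.level t v then 1 else 0) +
      ∑ i ∈ Finset.range N, if Straddles (π.level t) i (splitting π ι j s t c m) then
        δ / (ι.pmaxProd j s * ι.pmax j s) else 0
    have hφ : ∀ r, potential π ι t j N δ (s ++ [r]) ≤ φ (r j) := by
      intro r
      by_cases hv : ∃ v, splitting π ι τ.player s (state π ι s).1 (state π ι s).2 (r τ.player) =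
        PMF.pure v
      · obtain ⟨v, hv⟩ := hv
        have hne : v ≠ t := by
          obtain ⟨a, rfl⟩ :=
            CollabProtocol.exists_of_mem_support_innocentStep hτ' (mem_support_of_pure hv)
          rw [h]; simp
        rw [potential, state_append_of_pure hτ' hv, if_neg hne]
        exact zero_le
      · rw [potential, state_append_of_not_pure hτ' hv, if_pos h, h, ι.pmaxProd_append]
    refine (lintegral_mono hφ).trans ?_
    rw [lintegral_roundLaw_eval ι.dist s j φ, potential, if_pos h]
    simp only [φ, mul_add, Finset.mul_sum]
    rw [ENNReal.tsum_add, mean_splitting, Summable.tsum_finsetSum fun _ _ => ENNReal.summable]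
    gcongr with i hi
    refine (tsum_straddles_splitting_le j s t c i _).trans ?_
    split_ifs
    · rw [div_eq_mul_inv, ENNReal.mul_inv (Or.inl (ι.pmaxProd_ne_zero j s))
        (Or.inl (ι.pmaxProd_ne_top j s)), div_eq_mul_inv]
      calc ι.pmax j s * (δ * ((ι.pmaxProd j s)⁻¹ * (ι.pmax j s)⁻¹))
          = δ * (ι.pmaxProd j s)⁻¹ * (ι.pmax j s * (ι.pmax j s)⁻¹) := by ring
        _ ≤ _ := by
          rw [ENNReal.mul_inv_cancel (ι.pmax_ne_zero j s) (ι.pmax_ne_top j s), mul_one]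
    · simp
  · have h0 : ∀ r, potential π ι t τ.player N δ (s ++ [r]) = 0 := by
      intro r
      rw [potential, if_neg]
      intro h'
      have h1 := state_fst_prefix (π := π) (ι := ι) hs
      have h2 := state_fst_prefix (π := π) (ι := ι) (List.prefix_append s [r])
      rw [ht] at h1
      rw [h'] at h2
      exact h (h2.eq_of_length_le h1.length_le)
    simp [h0]

/-- A round that does not move on leaves a law that is no point mass. Either all its mass has level
at least `N`, and the first term is `1`, or two of its points are separated by a level below `N`,
whose term is at least `1`. The round `r` is needed because the law just after a commitment may be a
point mass. -/
theorem one_le_potential {s : List (Fin n → M)} {τ : Turn n 𝒳 𝒜} {r : Fin n → M}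
    (hτ : π.next (state π ι s).1 = some τ)
    (hr : (state π ι (s ++ [r])).1 = (state π ι s).1) {j : Fin n} {N : ℕ} {δ : ENNReal}
    (hδ : ι.pmaxProd j (s ++ [r]) ≤ δ) :
    1 ≤ potential π ι (state π ι s).1 j N δ (s ++ [r]) := by
  classical
  have hnp : ∀ v, (state π ι (s ++ [r])).2 ≠ PMF.pure v := by
    by_cases hv : ∃ v, splitting π ι τ.player s (state π ι s).1 (state π ι s).2 (r τ.player) =
      PMF.pure v
    · obtain ⟨v, hv⟩ := hv
      obtain ⟨a, ha⟩ :=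
        CollabProtocol.exists_of_mem_support_innocentStep hτ (mem_support_of_pure hv)
      rw [state_append_of_pure hτ hv, ha] at hr
      simp at hr
    · rw [state_append_of_not_pure hτ hv]
      exact fun v h => hv ⟨v, h⟩
  rw [potential, if_pos hr]
  have hsub := support_state_subset (π := π) (ι := ι) (s ++ [r])
  rw [hr] at hsub
  set c := (state π ι (s ++ [r])).2
  set t := (state π ι s).1
  by_cases hN : ∀ v ∈ c.support, N ≤ π.level t v
  · refine le_trans ?_ le_self_add
    rw [mean_congr (ψ := fun _ => 1) fun v hv => if_pos (hN v hv), mean_const]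
  · push Not at hN
    obtain ⟨v, hv, hvN⟩ := hN
    obtain ⟨v', hv', hne⟩ : ∃ v' ∈ c.support, v' ≠ v := by
      by_contra! h
      exact hnp v (eq_pure_of_support_subset h)
    have hlev : π.level t v' ≠ π.level t v :=
      fun h => hne (π.level_injOn t (hsub hv') (hsub hv) h)
    rw [PMF.mem_support_iff] at hv hv'
    obtain ⟨i, hi, hst⟩ : ∃ i < N, Straddles (π.level t) i c := by
      rcases lt_or_gt_of_ne hlev with h | h
      · exact ⟨_, h.trans hvN, ⟨v', hv', le_rfl⟩, v, hv, h⟩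
      · exact ⟨_, hvN, ⟨v, hv, le_rfl⟩, v', hv', h⟩
    refine le_trans ?_ le_add_self
    refine le_trans ?_ (Finset.single_le_sum (f := fun i => if Straddles (π.level t) i c then
        δ / ι.pmaxProd j (s ++ [r]) else 0) (fun _ _ => zero_le) (Finset.mem_range.2 hi))
    simp only [if_pos hst]
    rwa [ENNReal.le_div_iff_mul_le (Or.inl (ι.pmaxProd_ne_zero j _))
      (Or.inl (ι.pmaxProd_ne_top j _)), one_mul]

theorem tendsto_mean_tail {α : Type*} (c : PMF α) (e : α → ℕ) :
    Tendsto (fun N => mean c fun a => if N ≤ e a then 1 else 0) atTop (𝓝 0) := by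
  let _ : MeasurableSpace α := ⊤
  have h : ∀ N, mean c (fun a => if N ≤ e a then 1 else 0) = c.toMeasure {a | N ≤ e a} := by
    intro N
    rw [PMF.toMeasure_apply_eq_toOuterMeasure_apply c MeasurableSpace.measurableSet_top,
      PMF.toOuterMeasure_apply]
    refine tsum_congr fun a => ?_
    simp [Set.indicator]
  simp_rw [h]
  have := tendsto_measure_iInter_atTop (μ := c.toMeasure) (s := fun N => {a | N ≤ e a})
    (fun _ => MeasurableSpace.measurableSet_top.nullMeasurableSet)
    (fun N N' hN a (ha : N' ≤ e a) => hN.trans ha) ⟨0, measure_ne_top _ _⟩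
  have h0 : ⋂ N, {a | N ≤ e a} = ∅ := by
    ext a; simp only [Set.mem_iInter, Set.mem_ofPred_eq, Set.mem_empty_iff_false, iff_false]
    exact fun h => absurd (h (e a + 1)) (by omega)
  rwa [h0, measure_empty] at this

variable [Countable M] [MeasurableSpace M] [DiscreteMeasurableSpace M]

/-- The simulation does not stay at one turn forever. -/
theorem measure_stuck_eq_zero (hι : ι.Informative) {s : List (Fin n → M)} {τ : Turn n 𝒳 𝒜}
    (hτ : π.next (state π ι s).1 = some τ) :
    roundsLaw ι.dist (cylinderOf s ∩
      {ω | ∀ k ≥ s.length, (state π ι (pre ω k)).1 = (state π ι s).1}) = 0 := by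
  set j := τ.player with hj
  set t := (state π ι s).1 with ht
  -- By Fatou the stuck event costs at most the initial potential; afterwards `δ → 0`, then `N → ∞`.
  have hbound : ∀ (N : ℕ) (δ : ENNReal), δ ≠ 0 → roundsLaw ι.dist (cylinderOf s ∩
      {ω | ∀ k ≥ s.length, (state π ι (pre ω k)).1 = t}) ≤
      mean (state π ι s).2 (fun v => if N ≤ π.level t v then 1 else 0) +
        δ * (N * (ι.pmaxProd j s)⁻¹) := by
    classical
    intro N δ hδ
    have h1 : roundsLaw ι.dist (cylinderOf s) * potential π ι t j N δ s ≤
        mean (state π ι s).2 (fun v => if N ≤ π.level t v then 1 else 0) +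
        δ * (N * (ι.pmaxProd j s)⁻¹) := by
      refine (mul_le_of_le_one_left' prob_le_one).trans ?_
      rw [potential, if_pos rfl]
      gcongr
      refine (Finset.sum_le_sum (g := fun _ => δ / ι.pmaxProd j s) fun i _ => ?_).trans ?_
      · split_ifs <;> simp
      · rw [Finset.sum_const, Finset.card_range, nsmul_eq_mul, div_eq_mul_inv]
        exact le_of_eq (by ring)
    refine le_trans ?_ ((setLIntegral_liminf_le ι.dist
      (fun s' hs' => lintegral_potential_append_le hτ N δ hs')).trans h1)
    have hB : MeasurableSet (cylinderOf s ∩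
        {ω | ∀ k ≥ s.length, (state π ι (pre ω k)).1 = t}) := by
      refine (measurableSet_cylinderOf s).inter ?_
      simp only [Set.ofPred_forall]
      exact MeasurableSet.iInter fun k => MeasurableSet.iInter fun _ =>
        measurable_pre k (MeasurableSet.of_discrete (s := {l | (state π ι l).1 = t}))
    rw [← lintegral_indicator_one hB, ← lintegral_indicator (measurableSet_cylinderOf s)]
    refine lintegral_mono_ae ?_
    filter_upwards [hι j] with ω hω
    by_cases hωB : ω ∈ cylinderOf s ∩ {ω | ∀ k ≥ s.length, (state π ι (pre ω k)).1 = t}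
    · rw [Set.indicator_of_mem hωB, Set.indicator_of_mem hωB.1]
      refine le_liminf_of_le (by isBoundedDefault) ?_
      -- Informativeness enters here: the product of the `pmax` eventually drops below `δ`.
      have hev := (tendsto_order.1 hω).2 δ (pos_iff_ne_zero.2 hδ)
      obtain ⟨K, hK⟩ := eventually_atTop.1 hev
      refine eventually_atTop.2 ⟨max K s.length + 1, fun k' hk' => ?_⟩
      obtain ⟨k, rfl⟩ := Nat.exists_eq_add_of_le' (show 1 ≤ k' by omega)
      have hks : k ≥ s.length := by omega
      have hk := hK (k + 1) (by omega)
      have hk1 := hωB.2 k hks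
      have hk2 := hωB.2 (k + 1) (by omega)
      rw [← ι.pmaxProd_pre, pre_succ] at hk
      rw [pre_succ] at hk2 ⊢
      rw [← ht, ← hk1]
      exact one_le_potential (τ := τ) (hk1 ▸ hτ) (hk2.trans hk1.symm) hk.le
    · rw [Set.indicator_of_notMem hωB]
      exact zero_le
  have hbound' : ∀ N : ℕ, roundsLaw ι.dist (cylinderOf s ∩
      {ω | ∀ k ≥ s.length, (state π ι (pre ω k)).1 = t}) ≤
      mean (state π ι s).2 (fun v => if N ≤ π.level t v then 1 else 0) := by
    intro N
    have hC : (N : ENNReal) * (ι.pmaxProd j s)⁻¹ ≠ ⊤ :=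
      ENNReal.mul_ne_top (ENNReal.natCast_ne_top N) (ENNReal.inv_ne_top.2 (ι.pmaxProd_ne_zero j s))
    have h1 : Tendsto (fun δ : ENNReal => mean (state π ι s).2
        (fun v => if N ≤ π.level t v then 1 else 0) + δ * (N * (ι.pmaxProd j s)⁻¹)) (𝓝[>] 0)
        (𝓝 (mean (state π ι s).2 (fun v => if N ≤ π.level t v then 1 else 0) +
          0 * (N * (ι.pmaxProd j s)⁻¹))) :=
      (tendsto_const_nhds.add (ENNReal.Tendsto.mul_const tendsto_id (Or.inr hC))).mono_left
        nhdsWithin_le_nhds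
    rw [zero_mul, add_zero] at h1
    refine ge_of_tendsto h1 ?_
    filter_upwards [self_mem_nhdsWithin] with δ hδ
    exact hbound N δ (ne_of_gt hδ)
  exact le_zero_iff.1 (ge_of_tendsto' (tendsto_mean_tail _ _) hbound')

/-- The simulated communication stops almost surely. -/
theorem ae_exists_next_eq_none (hι : ι.Informative) :
    ∀ᵐ ω ∂roundsLaw ι.dist, ∃ k, π.next (state π ι (pre ω k)).1 = none := by
  -- Countably many partial transcripts, each with a null set of continuations that stay stuck.
  have h : ∀ᵐ ω ∂roundsLaw ι.dist, ∀ s, π.next (state π ι s).1 ≠ none →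
      ω ∉ cylinderOf s ∩ {ω | ∀ k ≥ s.length, (state π ι (pre ω k)).1 = (state π ι s).1} := by
    refine ae_all_iff.2 fun s => ?_
    by_cases hs : π.next (state π ι s).1 = none
    · exact ae_of_all _ fun ω hω => absurd hs hω
    · obtain ⟨τ, hτ⟩ := Option.ne_none_iff_exists'.1 hs
      filter_upwards [measure_eq_zero_iff_ae_notMem.1 (measure_stuck_eq_zero hι hτ)] with ω hω _
      exact hω
  filter_upwards [h] with ω hω
  by_contra! hnone
  -- If it never stops and never gets stuck, the simulated transcript outgrows `π.length`.
  have hlen : ∀ m, ∃ k, m ≤ (state π ι (pre ω k)).1.length := by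
    intro m
    induction m with
    | zero => exact ⟨0, Nat.zero_le _⟩
    | succ m ih =>
      obtain ⟨k, hk⟩ := ih
      by_contra! hm
      refine hω _ (hnone k) ⟨by rw [cylinderOf, Set.mem_ofPred_eq, length_pre], fun k' hk' => ?_⟩
      rw [length_pre] at hk'
      refine ((state_fst_prefix (pre_prefix_pre ω hk')).eq_of_length_le ?_).symm
      have := hm k'
      omega
  obtain ⟨k, hk⟩ := hlen π.length
  exact hnone k (π.terminates _ hk)

end Termination

/-! ### The final simulated transcript -/

theorem lintegral_toMeasure {α : Type*} [MeasurableSpace α] [MeasurableSingletonClass α]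
    (p : PMF α) (φ : α → ENNReal) : ∫⁻ a, φ a ∂p.toMeasure = mean p φ := by
  rw [← p.restrict_toMeasure_support, lintegral_countable _ p.support_countable]
  simp only [PMF.toMeasure_apply_singleton _ _ (measurableSet_singleton _)]
  rw [tsum_subtype p.support (fun a => φ a * p a)]
  refine tsum_congr fun a => ?_
  by_cases ha : a ∈ p.support
  · rw [Set.indicator_of_mem ha, mul_comm]
  · rw [Set.indicator_of_notMem ha, (p.apply_eq_zero_iff a).2 ha, zero_mul]

theorem toMeasure_withDensity {α : Type*} [MeasurableSpace α] [DiscreteMeasurableSpace α]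
    {p q : PMF α} {g : α → ENNReal} (h : ∀ a, q a = p a * g a) :
    p.toMeasure.withDensity g = q.toMeasure := by
  ext A hA
  rw [withDensity_apply _ hA, ← lintegral_indicator hA, lintegral_toMeasure, mean,
    PMF.toMeasure_apply q hA]
  refine tsum_congr fun a => ?_
  by_cases ha : a ∈ A <;> simp [ha, h]

section FinalTranscript

variable {n : ℕ} {𝒳 𝒜 M : Type*} {π : CollabProtocol n 𝒳 𝒜} {ι : InnocentProtocol n M}

theorem state_pre_of_none {ω : ℕ → Fin n → M} {k k' : ℕ}
    (h : π.next (state π ι (pre ω k)).1 = none) (hk : k ≤ k') :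
    state π ι (pre ω k') = state π ι (pre ω k) := by
  induction hk with
  | refl => rfl
  | step _ ih => rw [pre_succ, state_append_of_none (ih ▸ h), ih]

open Classical in
variable (π ι) in
/-- The complete simulated transcript of `π`, if the simulated communication stops. -/
def finalTranscript (ω : ℕ → Fin n → M) : List 𝒜 :=
  if h : ∃ k, π.next (state π ι (pre ω k)).1 = none then (state π ι (pre ω h.choose)).1 else []

theorem finalTranscript_eq {ω : ℕ → Fin n → M} {k : ℕ}
    (h : π.next (state π ι (pre ω k)).1 = none) :
    finalTranscript π ι ω = (state π ι (pre ω k)).1 := by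
  have hex : ∃ k, π.next (state π ι (pre ω k)).1 = none := ⟨k, h⟩
  rw [finalTranscript, dif_pos hex]
  rcases le_total hex.choose k with hk | hk
  · rw [state_pre_of_none hex.choose_spec hk]
  · rw [state_pre_of_none h hk]

variable [Countable M] [MeasurableSpace M] [DiscreteMeasurableSpace M]

theorem measurable_finalTranscript : Measurable (finalTranscript π ι) := by
  intro A _
  have h : finalTranscript π ι ⁻¹' A =
      (⋃ k, {ω | π.next (state π ι (pre ω k)).1 = none ∧ (state π ι (pre ω k)).1 ∈ A}) ∪
      {ω | (∀ k, ¬ π.next (state π ι (pre ω k)).1 = none) ∧ ([] : List 𝒜) ∈ A} := by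
    ext ω
    simp only [Set.mem_preimage, Set.mem_union, Set.mem_iUnion, Set.mem_ofPred_eq]
    by_cases hex : ∃ k, π.next (state π ι (pre ω k)).1 = none
    · obtain ⟨k, hk⟩ := hex
      constructor
      · intro hA; exact Or.inl ⟨k, hk, finalTranscript_eq hk ▸ hA⟩
      · rintro (⟨k, hk, hA⟩ | ⟨h, _⟩)
        · rwa [finalTranscript_eq hk]
        · exact absurd hk (h k)
    · rw [finalTranscript, dif_neg hex]
      push Not at hex
      simp [hex]
  rw [h]
  have hall : MeasurableSet {ω : ℕ → Fin n → M |
      ∀ k, ¬ π.next (state π ι (pre ω k)).1 = none} := by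
    simp only [Set.ofPred_forall]
    exact MeasurableSet.iInter fun k => measurable_pre k
      (MeasurableSet.of_discrete (s := {s | ¬ π.next (state π ι s).1 = none}))
  exact (MeasurableSet.iUnion fun k => measurable_pre k (MeasurableSet.of_discrete
    (s := {s | π.next (state π ι s).1 = none ∧ (state π ι s).1 ∈ A}))).union
    (hall.inter (MeasurableSet.const _))

/-- After stopping, the state is a point mass at the final transcript, so the supermartingale is
eventually constant with value `g` there; Fatou bounds its integral. -/
theorem setLIntegral_finalTranscript_le (hι : ι.Informative) {g : List 𝒜 → ENNReal}
    (hg : Superharmonic π g) (s : List (Fin n → M)) :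
    ∫⁻ ω in cylinderOf s, g (finalTranscript π ι ω) ∂roundsLaw ι.dist ≤
      roundsLaw ι.dist (cylinderOf s) * mean (state π ι s).2 g := by
  refine le_trans (le_of_eq ?_) (setLIntegral_liminf_le ι.dist
    (h := fun s => mean (state π ι s).2 g) fun s' _ => lintegral_mean_state_append_le hg s')
  refine lintegral_congr_ae (ae_restrict_of_ae ?_)
  filter_upwards [ae_exists_next_eq_none (π := π) hι] with ω ⟨k, hk⟩
  refine (Tendsto.liminf_eq (tendsto_nhds_of_eventually_eq ?_)).symm
  filter_upwards [eventually_ge_atTop k] with k' hk'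
  rw [state_pre_of_none hk hk', state_snd_of_none hk, mean_pure, finalTranscript_eq hk]

end FinalTranscript

/-! ### Runs of `π` among innocent players -/

namespace CollabProtocol

variable {n : ℕ} {𝒳 𝒜 : Type*} (π : CollabProtocol n 𝒳 𝒜)

/-- The distribution of the transcript `k` messages after `t`, if nobody is a leaker. -/
def innocentRun : ℕ → List 𝒜 → PMF (List 𝒜)
  | 0, t => PMF.pure t
  | k + 1, t => (π.innocentStep t).bind (innocentRun k)

theorem innocentRun_bind (k : ℕ) (t : List 𝒜) :
    (π.innocentRun k t).bind π.innocentStep = π.innocentRun (k + 1) t := by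
  induction k generalizing t with
  | zero => simp only [innocentRun, PMF.pure_bind, PMF.bind_pure]
  | succ k ih =>
    rw [innocentRun, PMF.bind_bind, innocentRun]
    congr 1
    exact funext ih

variable {π}

theorem innocentRun_of_none {t : List 𝒜} (h : π.next t = none) (k : ℕ) :
    π.innocentRun k t = PMF.pure t := by
  induction k with
  | zero => rfl
  | succ k ih => rw [innocentRun, innocentStep_of_none h, PMF.pure_bind, ih]

theorem innocentRun_succ_of_le {k : ℕ} {t : List 𝒜} (h : π.length ≤ k + t.length) :
    π.innocentRun (k + 1) t = π.innocentRun k t := by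
  induction k generalizing t with
  | zero =>
    have := π.terminates t (by omega)
    rw [innocentRun_of_none this, innocentRun_of_none this]
  | succ k ih =>
    cases ht : π.next t with
    | none => rw [innocentRun_of_none ht, innocentRun_of_none ht]
    | some τ =>
      rw [innocentRun, innocentRun, innocentStep_of_some ht, PMF.bind_map, PMF.bind_map]
      congr 1
      refine funext fun a => ih ?_
      simp only [List.length_append, List.length_singleton]
      omega

/-- The probability of ending in `A` from `t`. One further step changes nothing, since `π.length`
steps already reach the end from any `t`. -/
theorem superharmonic_innocentRun (A : Set (List 𝒜)) :
    Superharmonic π fun t => (π.innocentRun π.length t).toOuterMeasure A := by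
  intro t
  rw [mean, ← PMF.toOuterMeasure_bind_apply]
  exact le_of_eq (congrArg (fun p => PMF.toOuterMeasure p A)
    (innocentRun_succ_of_le (Nat.le_add_right _ _)))

end CollabProtocol

section Laws

variable {n : ℕ} {𝒳 𝒜 M : Type*} {π : CollabProtocol n 𝒳 𝒜} {ι : InnocentProtocol n M}
  [Countable M] [MeasurableSpace M] [DiscreteMeasurableSpace M]

/-- The probability of ending in `A` is superharmonic and becomes the indicator of `A` at the end;
this bounds one probability measure by the other. -/
theorem map_finalTranscript (hι : ι.Informative) :
    (roundsLaw ι.dist).map (finalTranscript π ι) = (π.innocentRun π.length []).toMeasure := by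
  classical
  have hm := measurable_finalTranscript (π := π) (ι := ι)
  have := Measure.isProbabilityMeasure_map (μ := roundsLaw ι.dist) hm.aemeasurable
  refine Measure.eq_of_le_of_isProbabilityMeasure (Measure.le_iff.2 fun A hA => ?_)
  rw [Measure.map_apply hm hA, PMF.toMeasure_apply_eq_toOuterMeasure_apply _ hA,
    ← lintegral_indicator_one (hm hA)]
  have h := setLIntegral_finalTranscript_le hι
    (CollabProtocol.superharmonic_innocentRun (π := π) A) []
  have huniv : cylinderOf ([] : List (Fin n → M)) = Set.univ := by
    ext; simp [cylinderOf, pre]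
  rw [roundsLaw_cylinderOf_nil, one_mul, state_nil, huniv, Measure.restrict_univ] at h
  refine le_trans (le_of_eq (lintegral_congr_ae ?_))
    (h.trans (CollabProtocol.superharmonic_innocentRun A []))
  filter_upwards [ae_exists_next_eq_none (π := π) hι] with ω ⟨k, hk⟩
  rw [finalTranscript_eq hk, CollabProtocol.innocentRun_of_none hk, PMF.toOuterMeasure_pure_apply]
  simp [Set.indicator, finalTranscript_eq hk]

end Laws

/-! ### Likelihood ratios against innocent play -/

namespace CollabProtocol

variable {n : ℕ} {𝒳 𝒜 : Type*} (π : CollabProtocol n 𝒳 𝒜)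

/-- How much more likely the next partial transcript after `t` is `v`, when `X = x` and `L = l`,
than when nobody is a leaker. -/
def stepRatio (x : 𝒳) (l : Fin n → Bool) (t v : List 𝒜) : ENNReal :=
  π.step x l t v / π.innocentStep t v

/-- How much more likely the partial transcript `t` is, when `X = x` and `L = l`, than when nobody
is a leaker. -/
def likelihood (x : 𝒳) (l : Fin n → Bool) (t : List 𝒜) : ENNReal :=
  List.reverseRecOn t 1 fun t a q => q * π.stepRatio x l t (t ++ [a])

variable {π}

theorem likelihood_nil (x : 𝒳) (l : Fin n → Bool) : π.likelihood x l [] = 1 :=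
  List.reverseRecOn_nil (motive := fun _ => ENNReal) ..

theorem likelihood_append (x : 𝒳) (l : Fin n → Bool) (t : List 𝒜) (a : 𝒜) :
    π.likelihood x l (t ++ [a]) = π.likelihood x l t * π.stepRatio x l t (t ++ [a]) :=
  List.reverseRecOn_concat (motive := fun _ => ENNReal) ..

theorem step_of_none {t : List 𝒜} (h : π.next t = none) (x : 𝒳) (l : Fin n → Bool) :
    π.step x l t = PMF.pure t := by rw [step, h]

theorem step_of_some {t : List 𝒜} {τ : Turn n 𝒳 𝒜} (h : π.next t = some τ) (x : 𝒳)
    (l : Fin n → Bool) : π.step x l t = (τ.message x l).map fun a => t ++ [a] := by rw [step, h]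

theorem map_append_apply (p : PMF 𝒜) (t : List 𝒜) (a : 𝒜) :
    p.map (fun a => t ++ [a]) (t ++ [a]) = p a := by
  classical
  rw [PMF.map_apply, tsum_eq_single a fun b hb => by simp [hb.symm]]
  simp

theorem likelihood_of_mem_support {t v : List 𝒜} {τ : Turn n 𝒳 𝒜} (h : π.next t = some τ)
    (hv : v ∈ (π.innocentStep t).support) (x : 𝒳) (l : Fin n → Bool) :
    π.likelihood x l v = π.likelihood x l t * π.stepRatio x l t v := by
  obtain ⟨a, rfl⟩ := exists_of_mem_support_innocentStep h hv
  exact likelihood_append x l t a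

theorem mean_likelihood {t : List 𝒜} {τ : Turn n 𝒳 𝒜} (h : π.next t = some τ)
    {c : PMF (List 𝒜)} (hc : c.support ⊆ (π.innocentStep t).support) (x : 𝒳) (l : Fin n → Bool) :
    mean c (π.likelihood x l) = π.likelihood x l t * mean c (π.stepRatio x l t) := by
  rw [← mean_const_mul]
  exact mean_congr fun v hv => likelihood_of_mem_support h (hc hv) x l

/-- The mean of `stepRatio` is the mass that `π.step` puts on transcripts possible for innocent
players. It falls short of one when a leaker can send what an innocent sender cannot. -/
theorem superharmonic_likelihood (x : 𝒳) (l : Fin n → Bool) :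
    Superharmonic π (π.likelihood x l) := by
  intro t
  cases h : π.next t with
  | none => rw [innocentStep_of_none h, mean_pure]
  | some τ =>
    rw [mean_likelihood h subset_rfl]
    refine mul_le_of_le_one_right' ?_
    rw [← (π.step x l t).tsum_coe]
    exact ENNReal.tsum_le_tsum fun v => ENNReal.mul_div_le

theorem stepRatio_of_not_leaker {t v : List 𝒜} {τ : Turn n 𝒳 𝒜} (h : π.next t = some τ)
    (hv : v ∈ (π.innocentStep t).support) (x : 𝒳) {l : Fin n → Bool} (hl : l τ.player = false) :
    π.stepRatio x l t v = 1 := by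
  have : π.step x l t = π.innocentStep t := by
    rw [step_of_some h, innocentStep_of_some h, Turn.message, hl]
    simp
  rw [stepRatio, this, ENNReal.div_self ((PMF.mem_support_iff _ _).1 hv) (PMF.apply_ne_top _ _)]

/-- A leaker's choice depends on `x` and not on who else is a leaker, so the simulated leaker can
compute this ratio without knowing `l`. -/
theorem stepRatio_of_leaker {t : List 𝒜} {τ : Turn n 𝒳 𝒜} (h : π.next t = some τ) (x : 𝒳)
    {l : Fin n → Bool} (hl : l τ.player = true) :
    π.stepRatio x l t = π.stepRatio x (fun _ => true) t := by
  have : π.step x l t = π.step x (fun _ => true) t := by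
    rw [step_of_some h, step_of_some h, Turn.message, Turn.message, hl]
  funext v
  rw [stepRatio, stepRatio, this]

theorem partialLaw_eq_mul_likelihood {μ : PMF (𝒳 × (Fin n → Bool))} (hπ : π.NonRevealing μ)
    {x : 𝒳} {l : Fin n → Bool} (hμ : μ (x, l) ≠ 0) (k : ℕ) (t : List 𝒜) :
    π.partialLaw x l k t = π.innocentRun k [] t * π.likelihood x l t := by
  induction k generalizing t with
  | zero =>
    rw [partialLaw, innocentRun]
    by_cases ht : t = []
    · rw [ht, likelihood_nil, mul_one]
    · rw [PMF.pure_apply, if_neg ht, zero_mul]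
  | succ k ih =>
    rw [partialLaw, ← innocentRun_bind, PMF.bind_apply, PMF.bind_apply, ← ENNReal.tsum_mul_right]
    refine tsum_congr fun u => ?_
    cases h : π.next u with
    | none =>
      rw [ih, step_of_none h, innocentStep_of_none h, PMF.pure_apply]
      split_ifs with htu
      · rw [htu]; ring
      · simp
    | some τ =>
      by_cases hex : ∃ a, t = u ++ [a]
      · obtain ⟨a, rfl⟩ := hex
        -- The one case where multiplying by the ratio could lose mass; non-revealing excludes it.
        by_cases h0 : π.innocentStep u (u ++ [a]) = 0
        · rw [h0, mul_zero, zero_mul]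
          by_contra hne
          rw [step_of_some h, map_append_apply] at hne
          rw [innocentStep_of_some h, map_append_apply] at h0
          obtain ⟨h1, h2⟩ := mul_ne_zero_iff.1 hne
          rw [Turn.message] at h2
          cases hl : l τ.player with
          | false => rw [hl] at h2; exact h2 h0
          | true =>
            rw [hl] at h2
            exact hπ u τ a h ⟨x, l, hμ, hl, ⟨k, h1⟩, h2⟩ h0
        · rw [ih, likelihood_append, stepRatio]
          calc π.innocentRun k [] u * π.likelihood x l u * π.step x l u (u ++ [a])
              = π.innocentRun k [] u * π.likelihood x l u * (π.innocentStep u (u ++ [a]) *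
                (π.step x l u (u ++ [a]) / π.innocentStep u (u ++ [a]))) := by
                rw [ENNReal.mul_div_cancel h0 (PMF.apply_ne_top _ _)]
            _ = _ := by ring
      · have h1 : ∀ p : PMF 𝒜, p.map (fun a => u ++ [a]) t = 0 := by
          intro p
          rw [PMF.apply_eq_zero_iff, PMF.mem_support_map_iff]
          rintro ⟨a, _, ha⟩
          exact hex ⟨a, ha.symm⟩
        rw [step_of_some h, innocentStep_of_some h, h1, h1, mul_zero, mul_zero, zero_mul]

end CollabProtocol

/-! ### The leakers' strategy and the law of the simulation -/

section Tilt

variable {M : Type*}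

open Classical in
/-- The distribution with density proportional to `φ` with respect to `P`, if it exists. -/
def tilt (P : PMF M) (φ : M → ENNReal) : PMF M :=
  if h : ∑' m, P m * φ m ≠ 0 ∧ ∑' m, P m * φ m ≠ ⊤ then
    PMF.normalize (fun m => P m * φ m) h.1 h.2 else P

theorem support_tilt_subset (P : PMF M) (φ : M → ENNReal) : (tilt P φ).support ⊆ P.support := by
  rw [tilt]
  split_ifs with h
  · intro m hm
    rw [PMF.support_normalize, Function.mem_support] at hm
    exact (PMF.mem_support_iff _ _).2 (left_ne_zero_of_mul hm)
  · exact subset_rfl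

theorem mul_eq_tilt_mul {P : PMF M} {φ : M → ENNReal} (h : ∑' m, P m * φ m ≠ ⊤) (m : M) :
    P m * φ m = tilt P φ m * ∑' m, P m * φ m := by
  by_cases h0 : ∑' m, P m * φ m = 0
  · rw [h0, mul_zero]
    exact ENNReal.tsum_eq_zero.1 h0 m
  · rw [tilt, dif_pos ⟨h0, h⟩, PMF.normalize_apply, mul_assoc, ENNReal.inv_mul_cancel h0 h, mul_one]

end Tilt

section Protocol

variable {n : ℕ} {𝒳 𝒜 M : Type*} (π : CollabProtocol n 𝒳 𝒜) (ι : InnocentProtocol n M)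

open Classical in
/-- The distribution from which player `j` chooses the message after `s` in the simulation of `π`,
if `j` is a leaker and the secret is `x`. -/
def simulationLeaker (x : 𝒳) (j : Fin n) (s : List (Fin n → M)) : PMF M :=
  if ∃ τ, π.next (state π ι s).1 = some τ ∧ τ.player = j then
    tilt (ι.dist j s) fun m => mean (splitting π ι j s (state π ι s).1 (state π ι s).2 m)
      (π.stepRatio x (fun _ => true) (state π ι s).1)
  else ι.dist j s

/-- The protocol on top of `ι` that simulates `π`. -/
def simulation : RoundProtocol n 𝒳 M where
  innocent := ι.dist
  leaker := simulationLeaker π ι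

theorem simulation_isOnTopOf : (simulation π ι).IsOnTopOf ι where
  innocent_eq _ _ := rfl
  leaker_subset x j s := by
    refine subset_trans ?_ (ι.support_subset j s)
    change (simulationLeaker π ι x j s).support ⊆ _
    rw [simulationLeaker]
    split_ifs
    · exact support_tilt_subset _ _
    · exact subset_rfl

variable {π ι}

theorem simulation_message_eq_dist {x : 𝒳} {l : Fin n → Bool} {j : Fin n} {s : List (Fin n → M)}
    (h : ∀ τ, π.next (state π ι s).1 = some τ → τ.player = j → l j = false) :
    (simulation π ι).message x l j s = ι.dist j s := by
  rw [RoundProtocol.message]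
  split_ifs with hl
  · change simulationLeaker π ι x j s = _
    rw [simulationLeaker, if_neg]
    rintro ⟨τ, hτ, hj⟩
    simp [h τ hτ hj] at hl
  · rfl

theorem simulation_message_of_leaker {x : 𝒳} {l : Fin n → Bool} {s : List (Fin n → M)}
    {τ : Turn n 𝒳 𝒜} (hτ : π.next (state π ι s).1 = some τ) (hl : l τ.player = true) :
    (simulation π ι).message x l τ.player s = tilt (ι.dist τ.player s) fun m =>
      mean (splitting π ι τ.player s (state π ι s).1 (state π ι s).2 m)
        (π.stepRatio x (fun _ => true) (state π ι s).1) := by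
  rw [RoundProtocol.message, if_pos hl]
  change simulationLeaker π ι x τ.player s = _
  rw [simulationLeaker, if_pos ⟨τ, hτ, rfl⟩]

variable [Countable M] [MeasurableSpace M] [DiscreteMeasurableSpace M]

/-- Tilting multiplies the probability of a message by the mean ratio after it over the mean ratio
before it, so these factors telescope along `s`. Commitments can only lower the left side, by
superharmonicity of the likelihood. -/
theorem roundsLaw_mul_mean_likelihood_le (x : 𝒳) (l : Fin n → Bool) (s : List (Fin n → M)) :
    roundsLaw ι.dist (cylinderOf s) * mean (state π ι s).2 (π.likelihood x l) ≤
      roundsLaw ((simulation π ι).message x l) (cylinderOf s) := by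
  induction s using List.reverseRecOn with
  | nil =>
    rw [roundsLaw_cylinderOf_nil, roundsLaw_cylinderOf_nil, one_mul, state_nil,
      ← CollabProtocol.likelihood_nil (π := π) x l]
    exact CollabProtocol.superharmonic_likelihood x l []
  | append_singleton s r ih =>
    rw [roundsLaw_cylinderOf_append, roundsLaw_cylinderOf_append]
    cases hτ : π.next (state π ι s).1 with
    | none =>
      have hm : ∀ j, (simulation π ι).message x l j s = ι.dist j s := fun j =>
        simulation_message_eq_dist fun τ h => by simp [hτ] at h
      simp only [hm]
      rw [state_append_of_none hτ, mul_right_comm]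
      gcongr
    | some τ =>
      refine (mul_le_mul_right (mean_state_append_le
        (CollabProtocol.superharmonic_likelihood x l) hτ r) _).trans ?_
      set t := (state π ι s).1
      set c := (state π ι s).2
      set P := roundsLaw ι.dist (cylinderOf s)
      have hc : c.support ⊆ (π.innocentStep t).support := support_state_subset s
      have hκ := fun m => (support_splitting_subset π ι τ.player s t c m).trans hc
      rw [CollabProtocol.mean_likelihood hτ (hκ _)]
      rw [CollabProtocol.mean_likelihood hτ hc] at ih
      cases hl : l τ.player with
      | false =>
        have hm : ∀ j, (simulation π ι).message x l j s = ι.dist j s := fun j =>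
          simulation_message_eq_dist fun τ' h hj => by
            rw [hτ, Option.some_inj] at h; rw [← hj, ← h, hl]
        have h1 : ∀ c : PMF (List 𝒜), c.support ⊆ (π.innocentStep t).support →
            mean c (π.stepRatio x l t) = 1 := fun c hc => by
          rw [mean_congr fun v hv => CollabProtocol.stepRatio_of_not_leaker hτ (hc hv) x hl,
            mean_const]
        simp only [hm]
        rw [h1 _ hc] at ih
        rw [h1 _ (hκ _), mul_right_comm]
        gcongr
      | true =>
        rw [CollabProtocol.stepRatio_of_leaker hτ x hl] at ih ⊢
        set V := mean c (π.stepRatio x (fun _ => true) t) with hV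
        set q := π.likelihood x l t
        by_cases hP : P = 0
        · simp [hP]
        by_cases hq : q = 0
        · simp [hq]
        -- An infinite mean would contradict the induction hypothesis, whose right side is a
        -- probability; hence the tilt can be normalised unless `V = 0`.
        have hVtop : V ≠ ⊤ := by
          intro h
          rw [h, ENNReal.mul_top hq, ENNReal.mul_top hP] at ih
          exact measure_ne_top _ _ (top_le_iff.1 ih)
        rw [← mean_splitting π ι τ.player s t c] at hV
        have key := mul_eq_tilt_mul (hV ▸ hVtop) (r τ.player)
        rw [← hV, ← simulation_message_of_leaker hτ hl] at key
        rw [← Finset.mul_prod_erase _ _ (Finset.mem_univ τ.player),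
          ← Finset.mul_prod_erase _ (fun j => (simulation π ι).message x l j s (r j))
            (Finset.mem_univ τ.player)]
        have hrest : ∏ j ∈ Finset.univ.erase τ.player, (simulation π ι).message x l j s (r j) =
            ∏ j ∈ Finset.univ.erase τ.player, ι.dist j s (r j) := by
          refine Finset.prod_congr rfl fun j hj => ?_
          rw [simulation_message_eq_dist fun τ' h hj' => ?_]
          rw [hτ, Option.some_inj] at h
          exact absurd (h ▸ hj'.symm) (Finset.ne_of_mem_erase hj)
        rw [hrest]
        set E := ∏ j ∈ Finset.univ.erase τ.player, ι.dist j s (r j)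
        calc P * (ι.dist τ.player s (r τ.player) * E) *
              (q * mean (splitting π ι τ.player s t c (r τ.player))
                (π.stepRatio x (fun _ => true) t))
            = P * q * E * (ι.dist τ.player s (r τ.player) *
              mean (splitting π ι τ.player s t c (r τ.player))
                (π.stepRatio x (fun _ => true) t)) := by ring
          _ = P * (q * V) * ((simulation π ι).message x l τ.player s (r τ.player) * E) := by
              rw [key]; ring
          _ ≤ _ := by gcongr

/-- The density has total mass one because, by non-revealing, it turns the innocent law of `π` into
`transcriptLaw`. The two bounds on cylinders then compare two probability measures. -/
theorem roundsLaw_simulation {μ : PMF (𝒳 × (Fin n → Bool))} (hπ : π.NonRevealing μ)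
    (hι : ι.Informative) {x : 𝒳} {l : Fin n → Bool} (hμ : μ (x, l) ≠ 0) :
    roundsLaw ((simulation π ι).message x l) =
      (roundsLaw ι.dist).withDensity (π.likelihood x l ∘ finalTranscript π ι) := by
  have hm := measurable_finalTranscript (π := π) (ι := ι)
  have hQ : IsProbabilityMeasure
      ((roundsLaw ι.dist).withDensity (π.likelihood x l ∘ finalTranscript π ι)) := by
    refine ⟨?_⟩
    rw [withDensity_apply _ MeasurableSet.univ, Measure.restrict_univ]
    have := lintegral_map (μ := roundsLaw ι.dist) (f := π.likelihood x l)
      Measurable.of_discrete hm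
    refine this.symm.trans ?_
    rw [map_finalTranscript hι, lintegral_toMeasure, ← (π.transcriptLaw x l).tsum_coe]
    exact tsum_congr fun t =>
      (CollabProtocol.partialLaw_eq_mul_likelihood hπ hμ π.length t).symm
  refine (eq_of_cylinderOf_le fun s => ?_).symm
  rw [withDensity_apply _ (measurableSet_cylinderOf s)]
  exact (setLIntegral_finalTranscript_le hι (CollabProtocol.superharmonic_likelihood x l) s).trans
    (roundsLaw_mul_mean_likelihood_le x l s)

end Protocol

end Cryptogenography
end

open Cryptogenography in
theorem mainTheorem8 {n : ℕ} {𝒳 𝒜 M : Type*}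
    [Nonempty 𝒳] [Countable 𝒳] [MeasurableSpace 𝒳] [DiscreteMeasurableSpace 𝒳]
    [Countable M] [MeasurableSpace M] [DiscreteMeasurableSpace M]
    (μ : PMF (𝒳 × (Fin n → Bool)))
    (π : CollabProtocol n 𝒳 𝒜) (hπ : π.NonRevealing μ)
    (ι : InnocentProtocol n M) (hι : ι.Informative) :
    ∃ ρ : RoundProtocol n 𝒳 M, ρ.IsOnTopOf ι ∧
      ∀ ν : PMF (𝒳 × (Fin n → Bool)), ν.support ⊆ μ.support →
        SamePosteriorLaw ν.toMeasure π.transcriptKernel ρ.transcriptKernel := by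
  refine ⟨simulation π ι, simulation_isOnTopOf π ι, fun ν hν => ?_⟩
  have hμ : ∀ θ, ν.toMeasure {θ} ≠ 0 → μ (θ.1, θ.2) ≠ 0 := fun θ hθ => by
    rw [PMF.toMeasure_apply_singleton _ _ (measurableSet_singleton _)] at hθ
    exact (PMF.mem_support_iff _ _).1 (hν ((PMF.mem_support_iff _ _).2 hθ))
  -- Innocent play of `ι` is the common reference measure for all `(x, l)`.
  refine samePosteriorLaw_of_withDensity ν.toMeasure _ _ (roundsLaw ι.dist)
    (measurable_finalTranscript (π := π) (ι := ι)) (g := fun θ => π.likelihood θ.1 θ.2)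
    (fun _ => Measurable.of_discrete) (fun θ hθ => roundsLaw_simulation hπ hι (hμ θ hθ))
    fun θ hθ => ?_
  rw [map_finalTranscript hι]
  exact (toMeasure_withDensity fun t =>
    CollabProtocol.partialLaw_eq_mul_likelihood hπ (hμ θ hθ) π.length t).symm
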